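/- Let $\mathcal C$ be an abelian category. Write $\operatorname{mod}\mathcal C$ for the (abelian) category of finitely presented functors $F\colon\mathcal C^{\mathrm{op}}\to\mathrm{Ab}$, i.e. those admitting an exact sequence $$\operatorname{Hom}_{\mathcal C}(-,X)\xrightarrow{\ f\circ-\ }\operatorname{Hom}_{\mathcal C}(-,Y)\to F\to 0 \qquad (f\colon X\to Y \text{ in } \mathcal C),$$ and $\operatorname{eff}\mathcal C\subseteq\operatorname{mod}\mathcal C$ for the full subcategory of those $F$ that admit such a presentation with $f$ an epimorphism. Let $\mathbf K^b(\mathcal C)$ be the homotopy category of bounded cochain complexes, $\mathbf{Ac}^b(\mathcal C)\subseteq\mathbf K^b(\mathcal C)$ the full subcategory of acyclic complexes, and $\mathbf D^b$ the bounded derived category. For a class $\mathcal S$ of objects of a triangulated category, $\operatorname{Thick}(\mathcal S)$ is the smallest thick subcategory containing $\mathcal S$; objects of $\operatorname{eff}\mathcal C$ are viewed in $\mathbf D^b(\operatorname{mod}\mathcal C)$ as complexes concentrated in degree $0$. Then: 1. Applying the Yoneda functor $\mathcal C\to\operatorname{mod}\mathcal C$, $X\mapsto\operatorname{Hom}_{\mathcal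 C}(-,X)$, degreewise induces a triangle equivalence $\mathbf K^b(\mathcal C)\xrightarrow{\sim}\mathbf D^b(\operatorname{mod}\mathcal C)$. 2. A complex in $\mathbf K^b(\mathcal C)$ lies in $\mathbf{Ac}^b(\mathcal C)$ if and only if its image lies in $\operatorname{Thick}(\operatorname{eff}\mathcal C)$, and the equivalence of (1) restricts to a triangle equivalence $\mathbf{Ac}^b(\mathcal C)\xrightarrow{\sim}\operatorname{Thick}(\operatorname{eff}\mathcal C)$. 3. The canonical functor $\mathbf K^b(\mathcal C)\to\mathbf D^b(\mathcal C)$ is the Verdier quotient functor with respect to $\mathbf{Ac}^b(\mathcal C)$. The Yoneda functor has an exact left adjoint $\operatorname{mod}\mathcal C\to\mathcal C$; the composite of the equivalence in (1) with the induced triangle functor $\mathbf D^b(\operatorname{mod}\mathcal C)\to\mathbf D^b(\mathcal C)$ is isomorphic, as a functor commuting with shifts, to $\mathbf K^b(\mathcal C)\to\mathbf D^b(\mathcal C)$. The objects annihilated by $\mathbf D^b(\operatorname{mod}\mathcal C)\to\mathbf D^b(\mathcal C)$ are exactly those of $\operatorname{Thick}(\operatorname{eff}\mathcal C)$, and this functor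 induces an equivalence $$\frac{\mathbf D^b(\operatorname{mod}\mathcal C)}{\operatorname{Thick}(\operatorname{eff}\mathcal C)}\xrightarrow{\ \sim\ }\mathbf D^b(\mathcal C).$$ 4. The triangulated category $\mathbf{Ac}^b(\mathcal C)$ is generated by the acyclic complexes of the form $\cdots\to0\to X^{n-1}\to X^n\to X^{n+1}\to0\to\cdots$ ($n\in\mathbb Z$): it is the smallest thick subcategory of $\mathbf K^b(\mathcal C)$ containing them, and also the smallest isomorphism-closed triangulated subcategory of $\mathbf K^b(\mathcal C)$ containing them. -/

import Mathlib

open CategoryTheory Limits ZeroObject Pretriangulated Triangulated Opposite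

universe w₁ w₂ v u

namespace DerivedAuslander

section FinitelyPresented

variable {C : Type u} [Category.{v} C] [Preadditive C]

/-- The functor `F : Cᵒᵖ ⥤ Ab` is the cokernel of `Hom(-, X) ⟶ Hom(-, Y)` for `f : X ⟶ Y`, i.e.
there is an exact sequence `Hom(-, X) ⟶ Hom(-, Y) ⟶ F ⟶ 0`, the first map being
composition with `f`. -/
def IsPresentedBy {X Y : C} (f : X ⟶ Y) (F : Cᵒᵖ ⥤ AddCommGrpCat.{v}) : Prop :=
  ∃ (p : preadditiveYoneda.obj Y ⟶ F) (w : preadditiveYoneda.map f ≫ p = 0),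
    (ShortComplex.mk (preadditiveYoneda.map f) p w).Exact ∧ Epi p

lemma isPresentedBy_iff {X Y : C} (f : X ⟶ Y) (F : Cᵒᵖ ⥤ AddCommGrpCat.{v}) :
    IsPresentedBy f F ↔ ∃ (p : preadditiveYoneda.obj Y ⟶ F),
      (∀ (Z : C) (x : F.obj (op Z)), ∃ h : Z ⟶ Y, p.app (op Z) h = x) ∧
      (∀ (Z : C) (h : Z ⟶ Y), p.app (op Z) h = 0 ↔ ∃ g : Z ⟶ X, g ≫ f = h) := by
  have key (p : preadditiveYoneda.obj Y ⟶ F) (w : preadditiveYoneda.map f ≫ p = 0) :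
      (ShortComplex.mk (preadditiveYoneda.map f) p w).Exact ↔
        ∀ (Z : Cᵒᵖ), ((ShortComplex.mk (preadditiveYoneda.map f) p w).map
          ((evaluation _ _).obj Z)).Exact := by
    constructor
    · intro h Z
      exact h.map _
    · intro h
      rw [ShortComplex.exact_iff_isZero_homology, Functor.isZero_iff]
      intro Z
      exact ((ShortComplex.exact_iff_isZero_homology _).1 (h Z)).of_iso
        (ShortComplex.mapHomologyIso _ ((evaluation _ _).obj Z)).symm
  have key' (p : preadditiveYoneda.obj Y ⟶ F) :
      Epi p ↔ ∀ (Z : C) (x : F.obj (op Z)), ∃ h : Z ⟶ Y, p.app (op Z) h = x := by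
    rw [NatTrans.epi_iff_epi_app]
    simp only [AddCommGrpCat.epi_iff_surjective]
    exact ⟨fun h Z => h (op Z), fun h Z => h Z.unop⟩
  constructor
  · rintro ⟨p, w, h, hp⟩
    refine ⟨p, (key' p).1 hp, fun Z k => ?_⟩
    have h1 := (ShortComplex.ab_exact_iff _).1 ((key p w).1 h (op Z))
    constructor
    · exact h1 k
    · rintro ⟨g, rfl⟩
      exact congr($(NatTrans.congr_app w (op Z)) g)
  · rintro ⟨p, hp, h⟩
    have w : preadditiveYoneda.map f ≫ p = 0 := by
      ext Z g
      exact (h Z.unop _).2 ⟨g, rfl⟩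
    refine ⟨p, w, ?_, (key' p).2 hp⟩
    rw [key]
    intro Z
    rw [ShortComplex.ab_exact_iff]
    intro k hk
    exact (h Z.unop k).1 hk

variable (C) in
/-- The finitely presented (coherent) functors `Cᵒᵖ ⥤ Ab`. -/
def isFinitelyPresented : ObjectProperty (Cᵒᵖ ⥤ AddCommGrpCat.{v}) := fun F =>
  ∃ (X Y : C) (f : X ⟶ Y), IsPresentedBy f F


lemma IsPresentedBy.of_iso {X Y : C} {f : X ⟶ Y} {F G : Cᵒᵖ ⥤ AddCommGrpCat.{v}}
    (e : F ≅ G) (h : IsPresentedBy f F) : IsPresentedBy f G := by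
  rw [isPresentedBy_iff] at h ⊢
  obtain ⟨p, hp, hf⟩ := h
  refine ⟨p ≫ e.hom, fun Z x => ?_, fun Z k => ?_⟩
  · obtain ⟨k, hk⟩ := hp Z (e.inv.app _ x)
    refine ⟨k, ?_⟩
    change e.hom.app _ (p.app _ k) = x
    rw [hk, ← ConcreteCategory.comp_apply, ← NatTrans.comp_app, e.inv_hom_id]
    rfl
  · rw [← hf]
    change e.hom.app _ (p.app _ k) = 0 ↔ _
    constructor
    · intro h
      have := congrArg (e.inv.app (op Z)) h
      rw [← ConcreteCategory.comp_apply, ← NatTrans.comp_app, e.hom_inv_id, map_zero] at this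
      exact this
    · intro h
      rw [h, map_zero]

instance : (isFinitelyPresented C).IsClosedUnderIsomorphisms where
  of_iso e := by
    rintro ⟨X, Y, f, h⟩
    exact ⟨X, Y, f, h.of_iso e⟩

/-- A morphism out of a representable functor is determined by the image of the identity. -/
lemma yoneda_app {Y : C} {F : Cᵒᵖ ⥤ AddCommGrpCat.{v}} (p : preadditiveYoneda.obj Y ⟶ F)
    {Z : C} (h : Z ⟶ Y) :
    p.app (op Z) h = F.map h.op (p.app (op Y) (𝟙 Y)) := by
  have := congr($(p.naturality h.op) (𝟙 Y))
  refine Eq.trans ?_ this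
  change _ = p.app (op Z) (h ≫ 𝟙 Y)
  rw [Category.comp_id]

lemma exists_lift {Y Y' : C} {F G : Cᵒᵖ ⥤ AddCommGrpCat.{v}} (φ : F ⟶ G)
    (p : preadditiveYoneda.obj Y ⟶ F) (p' : preadditiveYoneda.obj Y' ⟶ G)
    (hp' : ∀ (Z : C) (x : G.obj (op Z)), ∃ h : Z ⟶ Y', p'.app (op Z) h = x) :
    ∃ s : Y ⟶ Y', ∀ (Z : C) (h : Z ⟶ Y), p'.app (op Z) (h ≫ s) = φ.app _ (p.app (op Z) h) := by
  obtain ⟨s, hs⟩ := hp' Y (φ.app _ (p.app (op Y) (𝟙 Y)))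
  refine ⟨s, fun Z h => ?_⟩
  have h1 := yoneda_app (p ≫ φ) h
  have h2 := congr($(p'.naturality h.op) s)
  refine h2.trans (Eq.trans ?_ h1.symm)
  exact congrArg (G.map h.op) hs

lemma isFinitelyPresented_yoneda [HasZeroObject C] (X : C) :
    isFinitelyPresented C (preadditiveYoneda.obj X) := by
  refine ⟨X, X, 0, ?_⟩
  rw [isPresentedBy_iff]
  refine ⟨𝟙 _, fun Z x => ⟨x, rfl⟩, fun Z h => ?_⟩
  constructor
  · intro h'
    exact ⟨0, by rw [comp_zero]; exact h'.symm⟩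
  · rintro ⟨g, rfl⟩
    exact comp_zero

instance [HasZeroObject C] : (isFinitelyPresented C).ContainsZero where
  exists_zero := by
    refine ⟨0, isZero_zero _, 0, 0, 0, ?_⟩
    rw [isPresentedBy_iff]
    refine ⟨0, fun Z x => ⟨0, ?_⟩, fun Z h => ⟨fun _ => ⟨0, (isZero_zero C).eq_of_tgt _ _⟩,
      fun _ => rfl⟩⟩
    have : IsZero ((0 : Cᵒᵖ ⥤ AddCommGrpCat.{v}).obj (op Z)) :=
      ((Functor.isZero_iff _).1 (isZero_zero _)) _
    exact (AddCommGrpCat.subsingleton_of_isZero this).elim _ _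

instance [HasBinaryBiproducts C] : (isFinitelyPresented C).IsClosedUnderCokernels where
  cokernels_le := by
    rintro _ ⟨φ, k, hk, ⟨X, Y, f, h⟩, ⟨X', Y', f', h'⟩⟩
    rw [isPresentedBy_iff] at h h'
    obtain ⟨p, hp, hf⟩ := h
    obtain ⟨p', hp', hf'⟩ := h'
    obtain ⟨s, hs⟩ := exists_lift φ p p' hp'
    refine ⟨X' ⊞ Y, Y', biprod.desc f' s, ?_⟩
    rw [isPresentedBy_iff]
    have hk1 (Z : C) (x : k.pt.obj (op Z)) : ∃ y, k.π.app (op Z) y = x := by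
      have : Epi k.π := Cofork.IsColimit.epi hk
      rw [NatTrans.epi_iff_epi_app] at this
      exact (AddCommGrpCat.epi_iff_surjective _).1 (this (op Z)) x
    have hk2 (Z : C) (y) : k.π.app (op Z) y = 0 ↔ ∃ x, φ.app (op Z) x = y := by
      have h1 : (ShortComplex.mk φ k.π k.condition).Exact :=
        ShortComplex.exact_of_g_is_cokernel _ (hk.ofIsoColimit (Cofork.ext (Iso.refl _)))
      have h2 := (ShortComplex.ab_exact_iff _).1 (h1.map ((evaluation _ _).obj (op Z)))
      constructor
      · exact h2 y
      · rintro ⟨x, rfl⟩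
        exact congr($(NatTrans.congr_app k.condition (op Z)) x)
    refine ⟨p' ≫ k.π, fun Z x => ?_, fun Z h => ?_⟩
    · obtain ⟨y, rfl⟩ := hk1 Z x
      obtain ⟨h, rfl⟩ := hp' Z y
      exact ⟨h, rfl⟩
    · change k.π.app _ (p'.app _ h) = 0 ↔ _
      rw [hk2]
      constructor
      · rintro ⟨x, hx⟩
        obtain ⟨h₁, rfl⟩ := hp Z x
        rw [← hs] at hx
        have : p'.app (op Z) (h - h₁ ≫ s) = 0 := by
          refine ((p'.app (op Z)).hom.map_sub h (h₁ ≫ s)).trans ?_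
          exact sub_eq_zero.2 hx.symm
        obtain ⟨g, hg⟩ := (hf' _ _).1 this
        exact ⟨biprod.lift g h₁, by simp [hg]⟩
      · rintro ⟨g, rfl⟩
        refine ⟨p.app _ (g ≫ biprod.snd), ?_⟩
        rw [← hs]
        have : p'.app (op Z) ((g ≫ biprod.fst) ≫ f') = 0 := (hf' _ _).2 ⟨_, rfl⟩
        have h3 : g ≫ biprod.desc f' s = (g ≫ biprod.fst) ≫ f' + (g ≫ biprod.snd) ≫ s := by
          simp [biprod.desc_eq]
        rw [h3]
        refine Eq.trans ?_ ((p'.app (op Z)).hom.map_add _ _).symm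
        exact (congrArg (· + _) this).trans (zero_add _) |>.symm

instance [HasPullbacks C] : (isFinitelyPresented C).IsClosedUnderKernels where
  kernels_le := by
    rintro _ ⟨φ, k, hk, ⟨X, Y, f, h⟩, ⟨X', Y', f', h'⟩⟩
    rw [isPresentedBy_iff] at h h'
    obtain ⟨p, hp, hf⟩ := h
    obtain ⟨p', hp', hf'⟩ := h'
    obtain ⟨s, hs⟩ := exists_lift φ p p' hp'
    have hk1 (Z : C) (x y : k.pt.obj (op Z)) (hxy : k.ι.app (op Z) x = k.ι.app (op Z) y) :
        x = y := by
      have : Mono k.ι := Fork.IsLimit.mono hk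
      rw [NatTrans.mono_iff_mono_app] at this
      exact (AddCommGrpCat.mono_iff_injective _).1 (this (op Z)) hxy
    have hk2 (Z : C) (y) (hy : φ.app (op Z) y = 0) : ∃ x, k.ι.app (op Z) x = y := by
      have h1 : (ShortComplex.mk k.ι φ k.condition).Exact :=
        ShortComplex.exact_of_f_is_kernel _ (hk.ofIsoLimit (Fork.ext (Iso.refl _)))
      exact (ShortComplex.ab_exact_iff _).1 (h1.map ((evaluation _ _).obj (op Z))) y hy
    have hw : (preadditiveYoneda.map (pullback.fst s f') ≫ p) ≫ φ = 0 := by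
      ext Z h
      change Z.unop ⟶ pullback s f' at h
      refine (hs Z.unop (h ≫ pullback.fst s f')).symm.trans ((hf' _ _).2 ?_)
      exact ⟨h ≫ pullback.snd s f', by simp [pullback.condition]⟩
    obtain ⟨q, hq⟩ := KernelFork.IsLimit.lift' hk _ hw
    have hq' (Z : C) (h : Z ⟶ pullback s f') :
        k.ι.app (op Z) (q.app (op Z) h) = p.app (op Z) (h ≫ pullback.fst s f') :=
      congr($(NatTrans.congr_app hq (op Z)) h)
    refine ⟨pullback (pullback.fst s f') f, pullback s f',
      pullback.fst (pullback.fst s f') f, ?_⟩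
    rw [isPresentedBy_iff]
    refine ⟨q, fun Z x => ?_, fun Z h => ?_⟩
    · obtain ⟨h, hh⟩ := hp Z (k.ι.app _ x)
      have h0 : p'.app (op Z) (h ≫ s) = 0 := by
        rw [hs, hh]
        exact congr($(NatTrans.congr_app k.condition (op Z)) x)
      obtain ⟨t, ht⟩ := (hf' _ _).1 h0
      refine ⟨pullback.lift h t ht.symm, hk1 _ _ _ ?_⟩
      rw [hq', pullback.lift_fst, hh]
    · have h0 : q.app (op Z) h = 0 ↔ p.app (op Z) (h ≫ pullback.fst s f') = 0 := by
        rw [← hq']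
        exact ⟨fun h => by rw [h, map_zero], fun h => hk1 _ _ _ (by rw [h, map_zero])⟩
      rw [h0, hf]
      constructor
      · rintro ⟨g, hg⟩
        exact ⟨pullback.lift h g hg.symm, pullback.lift_fst _ _ _⟩
      · rintro ⟨g, rfl⟩
        exact ⟨g ≫ pullback.snd _ _, by simp [pullback.condition]⟩

lemma isFinitelyPresented_biprod [HasBinaryBiproducts C] {F G : Cᵒᵖ ⥤ AddCommGrpCat.{v}}
    (hF : isFinitelyPresented C F) (hG : isFinitelyPresented C G) :
    isFinitelyPresented C (F ⊞ G) := by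
  obtain ⟨X, Y, f, h⟩ := hF
  obtain ⟨X', Y', f', h'⟩ := hG
  rw [isPresentedBy_iff] at h h'
  obtain ⟨p, hp, hf⟩ := h
  obtain ⟨p', hp', hf'⟩ := h'
  refine ⟨X ⊞ X', Y ⊞ Y', biprod.map f f', ?_⟩
  rw [isPresentedBy_iff]
  let q : preadditiveYoneda.obj (Y ⊞ Y') ⟶ F ⊞ G :=
    biprod.lift (preadditiveYoneda.map biprod.fst ≫ p) (preadditiveYoneda.map biprod.snd ≫ p')
  have h1 (Z : C) (h : Z ⟶ Y ⊞ Y') : (biprod.fst : F ⊞ G ⟶ F).app (op Z) (q.app (op Z) h) =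
      p.app (op Z) (h ≫ biprod.fst) :=
    congr($(NatTrans.congr_app (biprod.lift_fst (preadditiveYoneda.map biprod.fst ≫ p)
      (preadditiveYoneda.map biprod.snd ≫ p')) (op Z)) h)
  have h2 (Z : C) (h : Z ⟶ Y ⊞ Y') : (biprod.snd : F ⊞ G ⟶ G).app (op Z) (q.app (op Z) h) =
      p'.app (op Z) (h ≫ biprod.snd) :=
    congr($(NatTrans.congr_app (biprod.lift_snd (preadditiveYoneda.map biprod.fst ≫ p)
      (preadditiveYoneda.map biprod.snd ≫ p')) (op Z)) h)
  have h3 (Z : C) (x y : (F ⊞ G).obj (op Z))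
      (e₁ : (biprod.fst : F ⊞ G ⟶ F).app (op Z) x = (biprod.fst : F ⊞ G ⟶ F).app (op Z) y)
      (e₂ : (biprod.snd : F ⊞ G ⟶ G).app (op Z) x = (biprod.snd : F ⊞ G ⟶ G).app (op Z) y) :
      x = y := by
    have key (z : (F ⊞ G).obj (op Z)) :
        (biprod.inl : F ⟶ F ⊞ G).app (op Z) ((biprod.fst : F ⊞ G ⟶ F).app (op Z) z) +
        (biprod.inr : G ⟶ F ⊞ G).app (op Z) ((biprod.snd : F ⊞ G ⟶ G).app (op Z) z) = z :=
      congr($(NatTrans.congr_app (biprod.total (X := F) (Y := G)) (op Z)) z)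
    rw [← key x, e₁, e₂, key y]
  refine ⟨q, fun Z x => ?_, fun Z h => ?_⟩
  · obtain ⟨h, hh⟩ := hp Z ((biprod.fst : F ⊞ G ⟶ F).app (op Z) x)
    obtain ⟨h', hh'⟩ := hp' Z ((biprod.snd : F ⊞ G ⟶ G).app (op Z) x)
    refine ⟨biprod.lift h h', h3 _ _ _ ?_ ?_⟩
    · rw [h1, biprod.lift_fst, hh]
    · rw [h2, biprod.lift_snd, hh']
  · have h0 : q.app (op Z) h = 0 ↔
        p.app (op Z) (h ≫ biprod.fst) = 0 ∧ p'.app (op Z) (h ≫ biprod.snd) = 0 := by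
      rw [← h1, ← h2]
      constructor
      · intro h
        rw [h, map_zero, map_zero]
        exact ⟨rfl, rfl⟩
      · rintro ⟨e₁, e₂⟩
        exact h3 _ _ _ (by rw [e₁, map_zero]) (by rw [e₂, map_zero])
    rw [h0, hf, hf']
    constructor
    · rintro ⟨⟨g, hg⟩, ⟨g', hg'⟩⟩
      exact ⟨biprod.lift g g', by ext <;> simp [hg, hg']⟩
    · rintro ⟨g, rfl⟩
      exact ⟨⟨g ≫ biprod.fst, by simp⟩, ⟨g ≫ biprod.snd, by simp⟩⟩

instance [HasBinaryBiproducts C] : (isFinitelyPresented C).IsClosedUnderBinaryProducts where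
  limitsOfShape_le := by
    rintro B ⟨h⟩
    refine (isFinitelyPresented C).prop_of_iso ?_ (isFinitelyPresented_biprod
      (h.prop_diag_obj ⟨.left⟩) (h.prop_diag_obj ⟨.right⟩))
    exact biprod.isoProd _ _ ≪≫ 
      (HasLimit.isoOfNatIso (diagramIsoPair h.diag)).symm ≪≫
      (limit.isLimit h.diag).conePointUniqueUpToIso h.isLimit

instance [HasZeroObject C] [HasBinaryBiproducts C] :
    (isFinitelyPresented C).IsClosedUnderFiniteProducts := .mk'

end FinitelyPresented

section ModCategory

variable (C : Type u) [Category.{v} C] [Abelian C]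

/-- The category `mod C` of finitely presented functors `Cᵒᵖ ⥤ Ab`. It is abelian by the
closure properties above. -/
abbrev FinPresFunctor := (isFinitelyPresented C).FullSubcategory

/-- The Yoneda functor `C ⥤ mod C`, `X ↦ Hom(-, X)`. -/
noncomputable def yonedaMod : C ⥤ FinPresFunctor C :=
  (isFinitelyPresented C).lift preadditiveYoneda isFinitelyPresented_yoneda

instance : (yonedaMod C).Additive where
  map_add {X Y f g} := by
    ext Z h
    exact Preadditive.comp_add _ _ _ (h : Z.unop ⟶ X) f g

/-- The full subcategory `eff C` of `mod C`: functors `F` with an exact sequence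
`Hom(-, X) ⟶ Hom(-, Y) ⟶ F ⟶ 0` induced by an epimorphism `X ⟶ Y`. -/
def isEffaceable : ObjectProperty (FinPresFunctor C) := fun F =>
  ∃ (X Y : C) (f : X ⟶ Y), Epi f ∧ IsPresentedBy f F.obj

end ModCategory

section BoundedHomotopy

variable (C : Type u) [Category.{v} C] [Preadditive C]

/-- Cochain complexes `K` with `Kⁿ = 0` for `|n| ≫ 0`. -/
def isBoundedComplex : ObjectProperty (CochainComplex C ℤ) := fun K =>
  ∃ (a b : ℤ), K.IsStrictlyGE a ∧ K.IsStrictlyLE b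

/-- The objects of the homotopy category `K(C)` whose underlying complex is bounded. -/
def isBoundedHomotopy : ObjectProperty (HomotopyCategory C (.up ℤ)) :=
  (isBoundedComplex C).strictMap (HomotopyCategory.quotient _ _)

variable {C} in
lemma isBoundedHomotopy_quotient_obj_iff (K : CochainComplex C ℤ) :
    isBoundedHomotopy C ((HomotopyCategory.quotient _ _).obj K) ↔ isBoundedComplex C K := by
  refine ⟨?_, fun h ↦ ⟨_, h⟩⟩
  simp only [isBoundedHomotopy, ObjectProperty.strictMap_iff]
  rintro ⟨L, h, hL⟩
  obtain rfl : L = K := congr_arg Quotient.as hL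
  exact h

instance [HasZeroObject C] : (isBoundedHomotopy C).ContainsZero where
  exists_zero :=
    ⟨(HomotopyCategory.quotient _ _).obj 0, Functor.map_isZero _ (isZero_zero _), by
      rw [isBoundedHomotopy_quotient_obj_iff]
      exact ⟨0, 0, inferInstance, inferInstance⟩⟩

instance : (isBoundedHomotopy C).IsStableUnderShift ℤ where
  isStableUnderShiftBy n :=
    { le_shift K hK := by
        obtain ⟨K : CochainComplex _ _, rfl⟩ := K.quotient_obj_surjective
        rw [isBoundedHomotopy_quotient_obj_iff] at hK
        obtain ⟨a, b, _, _⟩ := hK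
        rw [ObjectProperty.prop_shift_iff, HomotopyCategory.shift_quotient_obj,
          isBoundedHomotopy_quotient_obj_iff]
        exact ⟨a - n, b - n, K.isStrictlyGE_shift a n (a - n) (by lia),
          K.isStrictlyLE_shift b n (b - n) (by lia)⟩ }

lemma isStrictlyLE_mappingCone [HasBinaryBiproducts C] {K L : CochainComplex C ℤ} (f : K ⟶ L)
    (n₁ n₂ n : ℤ) [K.IsStrictlyLE n₁] [L.IsStrictlyLE n₂] (hn₁ : n₁ ≤ n + 1)
    (hn₂ : n₂ ≤ n) :
    (CochainComplex.mappingCone f).IsStrictlyLE n := by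
  rw [CochainComplex.isStrictlyLE_iff]
  intro i hi
  simp only [CochainComplex.mappingCone.isZero_X_iff]
  exact ⟨K.isZero_of_isStrictlyLE n₁ _, L.isZero_of_isStrictlyLE n₂ _⟩

instance [HasZeroObject C] [HasBinaryBiproducts C] :
    (isBoundedHomotopy C).IsTriangulatedClosed₃ where
  ext₃' T hT h₁ h₂ := by
    obtain ⟨a₁, b₁, _, _⟩ : (isBoundedComplex C) T.obj₁.as := by
      rwa [← isBoundedHomotopy_quotient_obj_iff]
    obtain ⟨a₂, b₂, _, _⟩ : (isBoundedComplex C) T.obj₂.as := by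
      rwa [← isBoundedHomotopy_quotient_obj_iff]
    obtain ⟨f : T.obj₁.as ⟶ T.obj₂.as, hf⟩ :=
      (HomotopyCategory.quotient _ _).map_surjective T.mor₁
    refine ⟨_, ?_,
      ⟨Triangle.π₃.mapIso (isoTriangleOfIso₁₂ T _ hT
        (HomotopyCategory.mappingCone_triangleh_distinguished f)
        (Iso.refl _) (Iso.refl _) ?_)⟩⟩
    · refine (isBoundedHomotopy_quotient_obj_iff (CochainComplex.mappingCone f)).2 ?_
      exact ⟨min (a₁ - 1) a₂, max (b₁ - 1) b₂,
        CochainComplex.isStrictlyGE_mappingCone f a₁ a₂ _ (by simp) (by simp),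
        isStrictlyLE_mappingCone C f b₁ b₂ _ (by
          have := le_max_left (b₁ - 1) b₂
          lia) (by simp)⟩
    · refine Eq.trans (Category.comp_id _) (Eq.trans hf.symm ?_)
      exact (Category.id_comp _).symm

instance [HasZeroObject C] [HasBinaryBiproducts C] : (isBoundedHomotopy C).IsTriangulated where
  toIsTriangulatedClosed₂ := .of_isTriangulatedClosed₃

/-- The bounded homotopy category `Kᵇ(C)`, as a full subcategory of `K(C)`. -/
abbrev Kb := (isBoundedHomotopy C).FullSubcategory

/-- The inclusion `Kᵇ(C) ⥤ K(C)`. -/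
abbrev Kb.ι : Kb C ⥤ HomotopyCategory C (.up ℤ) := (isBoundedHomotopy C).ι

variable {C} {D : Type*} [Category* D] [Preadditive D]

/-- The functor `Kᵇ(C) ⥤ Kᵇ(D)` which applies an additive functor `F : C ⥤ D` degreewise. -/
noncomputable def mapKb (F : C ⥤ D) [F.Additive] : Kb C ⥤ Kb D :=
  (isBoundedHomotopy D).lift (Kb.ι C ⋙ F.mapHomotopyCategory (.up ℤ)) (by
    rintro ⟨X, hX⟩
    obtain ⟨K : CochainComplex C ℤ, rfl⟩ := HomotopyCategory.quotient_obj_surjective X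
    rw [isBoundedHomotopy_quotient_obj_iff] at hX
    obtain ⟨a, b, _, _⟩ := hX
    refine (isBoundedHomotopy_quotient_obj_iff ((F.mapHomologicalComplex _).obj K)).2 ?_
    exact ⟨a, b, inferInstance, inferInstance⟩)

noncomputable instance (F : C ⥤ D) [F.Additive] : (mapKb F).CommShift ℤ :=
  inferInstanceAs (((isBoundedHomotopy D).lift (Kb.ι C ⋙
    F.mapHomotopyCategory (.up ℤ)) _).CommShift ℤ)

instance [HasZeroObject C] [HasBinaryBiproducts C] [HasZeroObject D] [HasBinaryBiproducts D]
    (F : C ⥤ D) [F.Additive] : (mapKb F).IsTriangulated :=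
  inferInstanceAs (((isBoundedHomotopy D).lift (Kb.ι C ⋙
    F.mapHomotopyCategory (.up ℤ)) _).IsTriangulated)

end BoundedHomotopy

section BoundedDerived

open DerivedCategory DerivedCategory.TStructure

variable (A : Type u) [Category.{v} A] [Abelian A]

/-- The full subcategory `Acᵇ(A)` of acyclic complexes in `Kᵇ(A)`. -/
def isAcyclicKb : ObjectProperty (Kb A) :=
  (HomotopyCategory.subcategoryAcyclic A).inverseImage (Kb.ι A)

instance : (isAcyclicKb A).IsTriangulated :=
  inferInstanceAs ((HomotopyCategory.subcategoryAcyclic A).inverseImage (Kb.ι A)).IsTriangulated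

/-- The acyclic complexes of the form `⋯ ⟶ 0 ⟶ Xⁿ⁻¹ ⟶ Xⁿ ⟶ Xⁿ⁺¹ ⟶ 0 ⟶ ⋯`
(for some integer `n`). -/
def isShortAcyclicKb : ObjectProperty (Kb A) := fun X =>
  isAcyclicKb A X ∧ ∃ n : ℤ, CochainComplex.IsStrictlyGE X.obj.as (n - 1) ∧
    CochainComplex.IsStrictlyLE X.obj.as (n + 1)

variable [HasDerivedCategory.{w₁} A]

lemma isBounded_Q_obj (K : CochainComplex A ℤ) (hK : isBoundedComplex A K) :
    (t : TStructure (DerivedCategory A)).bounded (DerivedCategory.Q.obj K) := by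
  obtain ⟨a, b, _, _⟩ := hK
  exact ⟨⟨a, ⟨K, Iso.refl _, inferInstance⟩⟩, ⟨b, ⟨K, Iso.refl _, inferInstance⟩⟩⟩

/-- The canonical functor `Kᵇ(A) ⥤ Dᵇ(A)`. -/
noncomputable def Qb : Kb A ⥤ DerivedCategory.Bounded A :=
  (t : TStructure (DerivedCategory A)).bounded.lift (Kb.ι A ⋙ DerivedCategory.Qh) (by
    rintro ⟨X, hX⟩
    obtain ⟨K, rfl⟩ := HomotopyCategory.quotient_obj_surjective X
    rw [isBoundedHomotopy_quotient_obj_iff] at hX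
    exact ObjectProperty.prop_of_iso _ ((quotientCompQhIso A).symm.app K)
      (isBounded_Q_obj A K hX))

noncomputable instance : (Qb A).CommShift ℤ :=
  inferInstanceAs ((t.bounded.lift (Kb.ι A ⋙ DerivedCategory.Qh) _).CommShift ℤ)

instance : (Qb A).IsTriangulated :=
  inferInstanceAs ((t.bounded.lift (Kb.ι A ⋙ DerivedCategory.Qh) _).IsTriangulated)

/-- The functor `A ⥤ Dᵇ(A)` viewing an object as a complex concentrated in degree `0`. -/
noncomputable def singleDb : A ⥤ DerivedCategory.Bounded A :=
  (t : TStructure (DerivedCategory A)).bounded.lift (DerivedCategory.singleFunctor A 0)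
    (fun _ => ⟨⟨0, inferInstance⟩, ⟨0, inferInstance⟩⟩)

variable {A} {B : Type*} [Category* B] [Abelian B] [HasDerivedCategory.{w₂} B]

/-- The functor `Dᵇ(A) ⥤ Dᵇ(B)` induced by an exact functor `F : A ⥤ B`. -/
noncomputable def mapDb (F : A ⥤ B) [F.Additive] [PreservesFiniteLimits F]
    [PreservesFiniteColimits F] : DerivedCategory.Bounded A ⥤ DerivedCategory.Bounded B :=
  (t : TStructure (DerivedCategory B)).bounded.lift
    (DerivedCategory.Bounded.ι ⋙ F.mapDerivedCategory) (by
      rintro ⟨X, ⟨a, ⟨K, e, _⟩⟩, ⟨b, ⟨L, e', _⟩⟩⟩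
      refine ⟨⟨a, ⟨(F.mapHomologicalComplex (.up ℤ)).obj K, ?_, inferInstance⟩⟩,
        ⟨b, ⟨(F.mapHomologicalComplex (.up ℤ)).obj L, ?_, inferInstance⟩⟩⟩
      · exact F.mapDerivedCategory.mapIso e ≪≫ F.mapDerivedCategoryFactors.app K
      · exact F.mapDerivedCategory.mapIso e' ≪≫ F.mapDerivedCategoryFactors.app L)

noncomputable instance (F : A ⥤ B) [F.Additive] [PreservesFiniteLimits F]
    [PreservesFiniteColimits F] : (mapDb F).CommShift ℤ :=
  inferInstanceAs ((t.bounded.lift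
    (DerivedCategory.Bounded.ι ⋙ F.mapDerivedCategory) _).CommShift ℤ)

instance (F : A ⥤ B) [F.Additive] [PreservesFiniteLimits F]
    [PreservesFiniteColimits F] : (mapDb F).IsTriangulated :=
  inferInstanceAs ((t.bounded.lift
    (DerivedCategory.Bounded.ι ⋙ F.mapDerivedCategory) _).IsTriangulated)

end BoundedDerived

section YonedaDerived

variable (C : Type u) [Category.{v} C] [Abelian C] [HasDerivedCategory.{w₂} (FinPresFunctor C)]

/-- The functor `Kᵇ(C) ⥤ Dᵇ(mod C)` induced by the Yoneda functor: apply Yoneda degreewise,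
then pass to the derived category. -/
noncomputable def yonedaDb : Kb C ⥤ DerivedCategory.Bounded (FinPresFunctor C) :=
  mapKb (yonedaMod C) ⋙ Qb (FinPresFunctor C)

noncomputable instance : (yonedaDb C).CommShift ℤ :=
  inferInstanceAs ((mapKb (yonedaMod C) ⋙ Qb (FinPresFunctor C)).CommShift ℤ)

instance : (yonedaDb C).IsTriangulated :=
  inferInstanceAs ((mapKb (yonedaMod C) ⋙ Qb (FinPresFunctor C)).IsTriangulated)

/-- `Thick(eff C)`, the smallest thick subcategory of `Dᵇ(mod C)` containing the objects of
`eff C`, viewed as complexes concentrated in degree `0`. -/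
noncomputable def thickEff : ObjectProperty (DerivedCategory.Bounded (FinPresFunctor C)) :=
  ((isEffaceable C).map (singleDb (FinPresFunctor C))).triangEnvelope

instance : (thickEff C).IsTriangulated := by
  have : ((isEffaceable C).map (singleDb (FinPresFunctor C))).Nonempty := by
    refine ⟨_, (yonedaMod C).obj 0, ⟨0, 0, 0, inferInstance, ?_⟩, ⟨Iso.refl _⟩⟩
    rw [isPresentedBy_iff]
    refine ⟨𝟙 _, fun Z x => ⟨x, rfl⟩, fun Z h => ⟨fun _ => ⟨0, ?_⟩, fun _ => ?_⟩⟩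
    all_goals exact (isZero_zero C).eq_of_tgt (Y := Z) _ _
  dsimp only [thickEff]
  infer_instance

end YonedaDerived

end DerivedAuslander

open DerivedAuslander

/-! Representable functors are projective in `mod C`, and a functor `F` presented by `f : X ⟶ Y` has
the resolution `0 ⟶ Hom(-, ker f) ⟶ Hom(-, X) ⟶ Hom(-, Y) ⟶ F ⟶ 0`. Bounded complexes of
representables are K-projective, so `yonedaDb` is fully faithful (`yonedaDb_map_bijective`). By the
resolution its essential image contains `mod C` (`exists_yonedaDb_obj_iso_singleDb`); a bounded
object is built from its cohomology by shifts and extensions (`prop_of_prop_singleDb_homology`), so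
`yonedaDb` is an equivalence.

The left adjoint `L` of Yoneda sends `F` to `coker f`. It is exact, the point being that it
preserves monomorphisms, and it kills exactly the effaceable functors (`isEffaceable_iff_isZero`).
Since `L` commutes with cohomology, objects killed by `mapDb L` have effaceable cohomology, and the
same dévissage puts them in `Thick(eff C)` (`thickEff_iff_isZero`). Yoneda followed by `L` is the
identity, so `yonedaDb` followed by `mapDb L` is `Qb`: this matches acyclic complexes with
`Thick(eff C)`, and deduces the quotient statement for `mapDb L` from that for `Qb`, which rests on
right fractions with bounded apex (`isLocalization_of_rightFraction`).

For generation, the image of an acyclic complex has effaceable cohomology, and each effaceable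
functor is the image of a short acyclic complex `ker f ⟶ X ⟶ Y`. The dévissage uses no retracts, so
closure under direct summands is not needed. -/

namespace DerivedAuslander

/-! ### The Yoneda functor into `mod C` and its exact left adjoint -/

section YonedaMod

variable {C : Type u} [Category.{v} C] [Abelian C]

variable (C) in
/-- The Yoneda functor `C ⥤ mod C` is fully faithful. -/
noncomputable def yonedaModFullyFaithful : (yonedaMod C).FullyFaithful where
  preimage g := preadditiveYoneda.preimage g.hom
  map_preimage g := by
    ext1
    exact preadditiveYoneda.map_preimage g.hom
  preimage_map f := preadditiveYoneda.preimage_map f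

instance : (yonedaMod C).Full := (yonedaModFullyFaithful C).full

instance : (yonedaMod C).Faithful := (yonedaModFullyFaithful C).faithful

/-- A presentation of a functor `F` in `mod C` exhibits `F` as a cokernel in `mod C`. -/
lemma IsPresentedBy.exists_isColimit {X Y : C} {f : X ⟶ Y} {F : FinPresFunctor C}
    (h : IsPresentedBy f F.obj) :
    ∃ (p : (yonedaMod C).obj Y ⟶ F) (w : (yonedaMod C).map f ≫ p = 0),
      Nonempty (IsColimit (CokernelCofork.ofπ p w)) := by
  obtain ⟨p, w, h, hp⟩ := h
  let hc := h.gIsCokernel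
  have : Epi (ObjectProperty.homMk p : (yonedaMod C).obj Y ⟶ F) :=
    (isFinitelyPresented C).ι.epi_of_epi_map hp
  refine ⟨ObjectProperty.homMk p, by ext1; exact w,
    ⟨CokernelCofork.IsColimit.ofπ' _ _ fun {Z} k hk => ?_⟩⟩
  have hk' : preadditiveYoneda.map f ≫ k.hom = 0 := congr_arg (·.hom) hk
  refine ⟨ObjectProperty.homMk (hc.desc (CokernelCofork.ofπ k.hom hk')), ?_⟩
  ext1
  exact hc.fac (CokernelCofork.ofπ k.hom hk') WalkingParallelPair.one

/-- Epimorphisms of `mod C` are surjective on sections, and by Yoneda a map out of a representable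
is lifted by lifting one element. -/
instance projective_yonedaMod_obj (X : C) : Projective ((yonedaMod C).obj X) where
  factors {F G} φ e he := by
    have := (isFinitelyPresented C).preservesEpimorphisms_ι_of_isNormalMonoCategory
    have h1 : Epi e.hom := inferInstanceAs (Epi ((isFinitelyPresented C).ι.map e))
    rw [NatTrans.epi_iff_epi_app] at h1
    obtain ⟨X', Y, f, hf⟩ := F.property
    rw [isPresentedBy_iff] at hf
    obtain ⟨p, hp, -⟩ := hf
    -- The lift is made through the cover `Hom(-, Y) ⟶ F`, so that it comes from a morphism `s` of
    -- `C`.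
    obtain ⟨s, hs⟩ := exists_lift φ.hom (𝟙 _) (p ≫ e.hom) fun Z x => by
      obtain ⟨y, rfl⟩ := (AddCommGrpCat.epi_iff_surjective _).1 (h1 (op Z)) x
      obtain ⟨k, rfl⟩ := hp Z y
      exact ⟨k, rfl⟩
    refine ⟨ObjectProperty.homMk (preadditiveYoneda.map s ≫ p), ?_⟩
    ext Z k
    exact hs Z.unop k


/-- Maps from `F = coker Hom(-, f)` to `Hom(-, Z)` are maps `Y ⟶ Z` killed by `f`, that is, maps
`coker f ⟶ Z`. Hence `η : F ⟶ Hom(-, coker f)` is initial; arguing object by object avoids making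
presentations functorial. -/
instance : (yonedaMod C).IsRightAdjoint := by
  have (F : FinPresFunctor C) : HasInitial (StructuredArrow F (yonedaMod C)) := by
    obtain ⟨X, Y, f, hf⟩ := F.property
    obtain ⟨p, w, ⟨hp⟩⟩ := hf.exists_isColimit
    have : Epi p := Cofork.IsColimit.epi hp
    obtain ⟨η, hη⟩ := CokernelCofork.IsColimit.desc' hp
      ((yonedaMod C).map (cokernel.π f)) (by rw [← Functor.map_comp]; simp)
    dsimp at hη
    refine IsInitial.hasInitial (X := StructuredArrow.mk η) (IsInitial.ofUniqueHom
      (fun Z => StructuredArrow.homMk (cokernel.desc f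
        ((yonedaModFullyFaithful C).preimage (p ≫ Z.hom)) ?_) ?_) ?_)
    · apply (yonedaMod C).map_injective
      simp [reassoc_of% w]
    · rw [← cancel_epi p]
      dsimp
      rw [reassoc_of% hη, ← Functor.map_comp, cokernel.π_desc]
      simp
    · intro Z m
      ext
      rw [← cancel_epi (cokernel.π f)]
      apply (yonedaMod C).map_injective
      have := StructuredArrow.w m
      dsimp at this
      simp [← this, reassoc_of% hη]
  exact isRightAdjointOfStructuredArrowInitials _

variable (C) in
/-- The left adjoint `mod C ⥤ C` of the Yoneda functor. -/
noncomputable def yonedaModLeftAdjoint : FinPresFunctor C ⥤ C := (yonedaMod C).leftAdjoint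

variable (C) in
/-- The adjunction between `yonedaModLeftAdjoint C` and the Yoneda functor. -/
noncomputable def yonedaModAdjunction : yonedaModLeftAdjoint C ⊣ yonedaMod C :=
  Adjunction.ofIsRightAdjoint _

instance : (yonedaModLeftAdjoint C).Additive := (yonedaModAdjunction C).left_adjoint_additive

instance : PreservesFiniteColimits (yonedaModLeftAdjoint C) :=
  have := (yonedaModAdjunction C).leftAdjoint_preservesColimits
  inferInstance

/-- The adjoint is chosen abstractly; this computes it from any presentation as `coker f`, with the
projection read off from the unit. -/
lemma exists_isColimit_leftAdjoint_obj {X Y : C} {f : X ⟶ Y} {F : FinPresFunctor C}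
    {p : (yonedaMod C).obj Y ⟶ F} {w : (yonedaMod C).map f ≫ p = 0}
    (hp : IsColimit (CokernelCofork.ofπ p w)) :
    ∃ (c : Y ⟶ (yonedaModLeftAdjoint C).obj F) (wc : f ≫ c = 0),
      p ≫ (yonedaModAdjunction C).unit.app F = (yonedaMod C).map c ∧
      Nonempty (IsColimit (CokernelCofork.ofπ c wc)) := by
  have : Epi p := Cofork.IsColimit.epi hp
  obtain ⟨c, hc⟩ := (yonedaMod C).map_surjective (p ≫ (yonedaModAdjunction C).unit.app F)
  have wc : f ≫ c = 0 := by
    apply (yonedaMod C).map_injective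
    simp [hc, reassoc_of% w]
  refine ⟨c, wc, hc.symm, ⟨CokernelCofork.IsColimit.ofπ _ _ (fun {Z} k hk =>
    ((yonedaModAdjunction C).homEquiv F Z).symm (hp.desc (CokernelCofork.ofπ
      ((yonedaMod C).map k) (by rw [← Functor.map_comp, hk, Functor.map_zero])))) ?_ ?_⟩⟩
  · intro Z k hk
    apply (yonedaMod C).map_injective
    rw [Functor.map_comp, hc, Category.assoc, ← Adjunction.homEquiv_unit,
      Equiv.apply_symm_apply]
    exact hp.fac _ WalkingParallelPair.one
  · intro Z k hk m hm
    rw [Equiv.eq_symm_apply, ← cancel_epi p, Adjunction.homEquiv_unit, ← Category.assoc, ← hc,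
      ← Functor.map_comp, hm]
    exact (hp.fac (CokernelCofork.ofπ _ _) WalkingParallelPair.one).symm

/-- The non-formal half of exactness, by a chase with generalised elements. An element of `coker f`
killed in `coker f'` lifts, after refinement, to an element of `Y` whose image in `Y'` factors
through `f'`. Its class in `F` is then killed by the monomorphism `φ`, hence is zero, and so is its
class in `coker f`. -/
instance : (yonedaModLeftAdjoint C).PreservesMonomorphisms where
  preserves {F G} φ _ := by
    obtain ⟨X, Y, f, hf⟩ := F.property
    obtain ⟨p, w, ⟨hp⟩⟩ := hf.exists_isColimit
    obtain ⟨c, wc, hcη, ⟨hc⟩⟩ := exists_isColimit_leftAdjoint_obj hp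
    obtain ⟨X', Y', f', hf'⟩ := G.property
    obtain ⟨p', w', ⟨hp'⟩⟩ := hf'.exists_isColimit
    obtain ⟨c', wc', hcη', ⟨hc'⟩⟩ := exists_isColimit_leftAdjoint_obj hp'
    have : Epi p' := Cofork.IsColimit.epi hp'
    have : Epi c := Cofork.IsColimit.epi hc
    obtain ⟨s, hs⟩ := (yonedaMod C).map_surjective (Projective.factorThru (p ≫ φ) p')
    have hs' : (yonedaMod C).map s ≫ p' = p ≫ φ := by rw [hs, Projective.factorThru_comp]
    have hsc : s ≫ c' = c ≫ (yonedaModLeftAdjoint C).map φ := by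
      apply (yonedaMod C).map_injective
      rw [Functor.map_comp, Functor.map_comp, ← hcη, ← hcη', reassoc_of% hs', Category.assoc]
      congr 1
      exact (yonedaModAdjunction C).unit.naturality φ
    have hex : (ShortComplex.mk f' c' wc').Exact := ShortComplex.exact_of_g_is_cokernel _ hc'
    rw [Preadditive.mono_iff_cancel_zero]
    intro T t ht
    obtain ⟨T₁, π₁, _, u, hu⟩ := surjective_up_to_refinements_of_epi c t
    obtain ⟨T₂, π₂, _, g, hg⟩ := hex.exact_up_to_refinements (u ≫ s) (by
      dsimp
      rw [Category.assoc, hsc, ← reassoc_of% hu, ht, comp_zero])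
    dsimp at hg
    have h0 : (yonedaMod C).map (π₂ ≫ u) ≫ p = 0 := by
      rw [← cancel_mono φ, Category.assoc, ← hs', zero_comp, ← Functor.map_comp_assoc,
        Category.assoc, hg, Functor.map_comp, Category.assoc, w', comp_zero]
    have h1 : (π₂ ≫ u) ≫ c = 0 := by
      apply (yonedaMod C).map_injective
      rw [Functor.map_comp, ← hcη, reassoc_of% h0, zero_comp, Functor.map_zero]
    rw [← cancel_epi π₁, ← cancel_epi π₂, hu, comp_zero, comp_zero, ← Category.assoc, h1]

instance : PreservesFiniteLimits (yonedaModLeftAdjoint C) :=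
  have : (yonedaModLeftAdjoint C).PreservesHomology :=
    Functor.preservesHomology_of_preservesMonos_and_cokernels _
  Functor.preservesFiniteLimits_of_preservesHomology _

/-- The adjoint takes the value `coker f`, zero exactly when `f` is epi. So effaceability is
independent of the presentation. -/
lemma isEffaceable_iff_isZero (F : FinPresFunctor C) :
    isEffaceable C F ↔ IsZero ((yonedaModLeftAdjoint C).obj F) := by
  constructor
  · rintro ⟨X, Y, f, _, hf⟩
    obtain ⟨p, w, ⟨hp⟩⟩ := hf.exists_isColimit
    obtain ⟨c, wc, hcη, ⟨hc⟩⟩ := exists_isColimit_leftAdjoint_obj hp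
    have : Epi c := Cofork.IsColimit.epi hc
    exact IsZero.of_epi_eq_zero c (by rw [← cancel_epi f, wc, comp_zero])
  · intro h
    obtain ⟨X, Y, f, hf⟩ := F.property
    obtain ⟨p, w, ⟨hp⟩⟩ := hf.exists_isColimit
    obtain ⟨c, wc, hcη, ⟨hc⟩⟩ := exists_isColimit_leftAdjoint_obj hp
    exact ⟨X, Y, f, Preadditive.epi_of_isZero_cokernel' _ hc h, hf⟩

/-- The Yoneda functor followed by its left adjoint is isomorphic to the identity. -/
noncomputable def yonedaModCompLeftAdjointIso : yonedaMod C ⋙ yonedaModLeftAdjoint C ≅ 𝟭 C :=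
  asIso (yonedaModAdjunction C).counit

end YonedaMod

/-! ### A criterion for Verdier quotients -/

section VerdierQuotient

variable {T D : Type*} [Category* T] [Category* D] [HasZeroObject T] [HasZeroObject D]
  [HasShift T ℤ] [HasShift D ℤ] [Preadditive T] [Preadditive D]
  [∀ n : ℤ, (shiftFunctor T n).Additive] [∀ n : ℤ, (shiftFunctor D n).Additive]
  [Pretriangulated T] [Pretriangulated D]
  (F : T ⥤ D) [F.CommShift ℤ] [F.IsTriangulated] {B : ObjectProperty T}

lemma trW_iff_isIso_map (hB : ∀ X, B X ↔ IsZero (F.obj X)) {X Y : T} (s : X ⟶ Y) :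
    B.trW s ↔ IsIso (F.map s) := by
  obtain ⟨Z, g, h, hT⟩ := distinguished_cocone_triangle s
  have : IsZero (F.obj Z) ↔ IsIso (F.map s) :=
    Triangle.isZero₃_iff_isIso₁ _ (F.map_distinguished _ hT)
  rw [← this, ← hB]
  constructor
  · rintro ⟨Z', g', h', hT', hZ'⟩
    rw [hB] at hZ' ⊢
    exact hZ'.of_iso (F.mapIso (Triangle.π₃.mapIso
      (isoTriangleOfIso₁₂ _ _ hT hT' (Iso.refl _) (Iso.refl _)
        ((Category.comp_id s).trans (Category.id_comp s).symm))))
  · exact fun hZ => ⟨Z, g, h, hT, hZ⟩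

/-- An essentially surjective triangulated functor which is full up to right fractions is the
Verdier quotient functor by its kernel. -/
lemma isLocalization_of_rightFraction [IsTriangulated T] [B.IsTriangulated] [F.EssSurj]
    (hB : ∀ X, B X ↔ IsZero (F.obj X))
    (hF : ∀ ⦃X Y : T⦄ (φ : F.obj X ⟶ F.obj Y), ∃ (X' : T) (s : X' ⟶ X) (_ : IsIso (F.map s))
      (g : X' ⟶ Y), φ = inv (F.map s) ≫ F.map g) :
    F.IsLocalization B.trW := by
  have hW : B.trW.IsInvertedBy F := fun X Y s hs => (trW_iff_isIso_map F hB s).1 hs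
  let Q := B.trW.Q
  let G : B.trW.Localization ⥤ D := Localization.lift F hW Q
  let e : Q ⋙ G ≅ F := Localization.fac F hW Q
  have : G.Full := G.full_of_comp_essSurj Q fun X Y φ => by
    obtain ⟨X', s, hs, g, hg⟩ := hF (e.inv.app X ≫ φ ≫ e.hom.app Y)
    have : IsIso (Q.map s) := Localization.inverts Q B.trW s ((trW_iff_isIso_map F hB s).2 hs)
    refine ⟨inv (Q.map s) ≫ Q.map g, ?_⟩
    rw [← cancel_epi (G.map (Q.map s)), ← Functor.map_comp, IsIso.hom_inv_id_assoc,
      ← cancel_mono (e.hom.app Y)]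
    have h1 : G.map (Q.map g) ≫ e.hom.app Y = e.hom.app X' ≫ F.map g := e.hom.naturality g
    have h2 : G.map (Q.map s) ≫ e.hom.app X = e.hom.app X' ≫ F.map s := e.hom.naturality s
    have h3 : e.hom.app X ≫ e.inv.app X = 𝟙 (G.obj (Q.obj X)) := e.hom_inv_id_app X
    have h4 : F.map s ≫ e.inv.app X ≫ φ ≫ e.hom.app Y = F.map g := by
      rw [hg, IsIso.hom_inv_id_assoc]
    rw [h1, ← h4, ← reassoc_of% h2, reassoc_of% h3, Category.assoc]
  have : G.Additive := by
    rw [Localization.functor_additive_iff Q B.trW]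
    exact Functor.additive_of_iso e.symm
  -- By calculus of fractions it suffices to treat morphisms `Q.map f` killed by `G`.
  have : G.Faithful := Functor.faithful_of_comp_cancel_zero_of_hasLeftCalculusOfFractions Q
    B.trW G fun X Y f hf => by
      replace hf : F.map f = 0 := by
        have : G.map (Q.map f) ≫ e.hom.app Y = e.hom.app X ≫ F.map f := e.hom.naturality f
        rw [← cancel_epi (e.hom.app X), ← this, hf, zero_comp, comp_zero]
      -- As `F.map f = 0`, the map `F.map k` has a section `r`. Writing `r` as a fraction with
      -- denominator `s` and numerator `g` gives `F.map (g ≫ k) = F.map s`, so `Q.map (g ≫ k)` is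
      -- invertible; it kills `Q.map f` because `k ≫ f = 0`.
      obtain ⟨W, k, d, hT⟩ := distinguished_cocone_triangle₁ f
      obtain ⟨r, hr⟩ : ∃ r : F.obj X ⟶ F.obj W, 𝟙 _ = r ≫ F.map k :=
        Triangle.coyoneda_exact₂ _ (F.map_distinguished _ hT) (𝟙 (F.obj X))
          (show 𝟙 _ ≫ F.map f = 0 by rw [hf, comp_zero])
      obtain ⟨X', s, hs, g, hg⟩ := hF r
      rw [hg, Category.assoc, eq_comm, IsIso.inv_comp_eq, Category.comp_id] at hr
      have hgk : F.map (g ≫ k) = F.map s := by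
        rw [F.map_comp, hr]
      have : IsIso (Q.map (g ≫ k)) := Localization.inverts Q B.trW _
        ((trW_iff_isIso_map F hB _).2 (by rw [hgk]; exact hs))
      rw [← cancel_epi (Q.map (g ≫ k)), ← Q.map_comp, Category.assoc,
        show k ≫ f = 0 from comp_distTriang_mor_zero₁₂ _ hT]
      simp
  have : G.EssSurj := ⟨fun Y => ⟨Q.obj (F.objPreimage Y),
    ⟨e.app _ ≪≫ F.objObjPreimageIso Y⟩⟩⟩
  have : G.IsEquivalence := {}
  exact Functor.IsLocalization.of_equivalence_target Q B.trW F G.asEquivalence e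

end VerdierQuotient

/-! ### The bounded derived category as a quotient of the bounded homotopy category -/

section BoundedDerived

open DerivedCategory DerivedCategory.TStructure

section

variable (A : Type u) [Category.{v} A] [Preadditive A]

/-- The object of `Kᵇ(A)` attached to a bounded complex. -/
abbrev Kb.mk (K : CochainComplex A ℤ) (hK : isBoundedComplex A K) : Kb A :=
  ⟨(HomotopyCategory.quotient A (.up ℤ)).obj K, (isBoundedHomotopy_quotient_obj_iff K).2 hK⟩

variable {A} in
lemma Kb.exists_eq_mk (X : Kb A) : ∃ (K : CochainComplex A ℤ) (hK : isBoundedComplex A K),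
    X = Kb.mk A K hK := by
  obtain ⟨⟨K⟩, hK⟩ := X
  exact ⟨K, (isBoundedHomotopy_quotient_obj_iff K).1 hK, rfl⟩

variable {A} in
/-- The morphism in `Kᵇ(A)` attached to a morphism of bounded complexes. -/
abbrev Kb.mkHom {K L : CochainComplex A ℤ} (f : K ⟶ L) (hK : isBoundedComplex A K)
    (hL : isBoundedComplex A L) : Kb.mk A K hK ⟶ Kb.mk A L hL :=
  ObjectProperty.homMk ((HomotopyCategory.quotient A (.up ℤ)).map f)

end

variable (A : Type u) [Category.{v} A] [Abelian A] [HasDerivedCategory.{w₁} A]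

lemma isZero_Qh_obj_iff (X : HomotopyCategory A (.up ℤ)) :
    IsZero (Qh.obj X) ↔ HomotopyCategory.subcategoryAcyclic A X := by
  rw [HomotopyCategory.mem_subcategoryAcyclic_iff]
  have h (n : ℤ) : IsZero ((HomotopyCategory.homologyFunctor A (.up ℤ) n).obj X) ↔
      IsZero ((DerivedCategory.homologyFunctor A n).obj (Qh.obj X)) :=
    ((homologyFunctorFactorsh A n).app X).symm.isZero_iff
  simp only [h]
  refine ⟨fun hX n => (DerivedCategory.homologyFunctor A n).map_isZero hX, fun hX => ?_⟩
  have : IsIso (0 : Qh.obj X ⟶ 0) := by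
    rw [DerivedCategory.isIso_iff]
    exact fun n => (isIso_of_source_target_iso_zero _ (hX n).isoZero
      (Functor.map_isZero _ (isZero_zero _)).isoZero)
  exact (isZero_zero _).of_iso (asIso (0 : Qh.obj X ⟶ 0))

lemma isZero_bounded_iff (X : Bounded A) : IsZero X ↔ IsZero X.obj :=
  ⟨fun h => Bounded.ι.map_isZero h, fun h => IsZero.of_full_of_faithful_of_isZero Bounded.ι X h⟩

lemma isAcyclicKb_iff_isZero (X : Kb A) : isAcyclicKb A X ↔ IsZero ((Qb A).obj X) := by
  rw [isZero_bounded_iff]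
  exact (isZero_Qh_obj_iff A X.obj).symm

/-- The canonical functor `Kᵇ(A) ⥤ Dᵇ(A)` is induced by `Q` on bounded complexes. -/
noncomputable def QbObjIso (K : CochainComplex A ℤ) (hK : isBoundedComplex A K) :
    ((Qb A).obj (Kb.mk A K hK)).obj ≅ Q.obj K :=
  (quotientCompQhIso A).app K

lemma QbObjIso_naturality {K L : CochainComplex A ℤ} (hK : isBoundedComplex A K)
    (hL : isBoundedComplex A L) (f : K ⟶ L) :
    ((Qb A).map (Kb.mkHom f hK hL)).hom ≫ (QbObjIso A L hL).hom =
      (QbObjIso A K hK).hom ≫ Q.map f :=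
  (quotientCompQhIso A).hom.naturality f

instance : (Qb A).EssSurj where
  mem_essImage Y := by
    have : Y.obj.IsGE Y.property.1.choose := Y.property.1.choose_spec
    have : Y.obj.IsLE Y.property.2.choose := Y.property.2.choose_spec
    obtain ⟨K, h₁, h₂, ⟨e⟩⟩ := exists_iso_Q_obj_of_isGE_of_isLE Y.obj
      Y.property.1.choose Y.property.2.choose
    exact ⟨⟨(HomotopyCategory.quotient A (.up ℤ)).obj K,
      (isBoundedHomotopy_quotient_obj_iff K).2 ⟨_, _, h₁, h₂⟩⟩,
      ⟨Bounded.ι.preimageIso ((quotientCompQhIso A).app K ≪≫ e.symm)⟩⟩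

instance : (Qb A).IsLocalization (isAcyclicKb A).trW := by
  refine isLocalization_of_rightFraction (Qb A) (isAcyclicKb_iff_isZero A) ?_
  intro X Y φ
  obtain ⟨X, hX, rfl⟩ := X.exists_eq_mk
  obtain ⟨Y, hY, rfl⟩ := Y.exists_eq_mk
  obtain ⟨a, b, _, _⟩ := id hX
  obtain ⟨a', b', _, _⟩ := id hY
  -- A lower bound common to `X` and `Y`, together with an upper bound of `X`, keeps the apex of the
  -- fraction bounded.
  have := X.isStrictlyGE_of_ge (min a a') a (by simp)
  have := Y.isStrictlyGE_of_ge (min a a') a' (by simp)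
  obtain ⟨X', h₁, h₂, s, hs, g, fac⟩ := right_fac_of_isStrictlyLE_of_isStrictlyGE (min a a') b
    ((QbObjIso A X hX).inv ≫ φ.hom ≫ (QbObjIso A Y hY).hom)
  have hX' : isBoundedComplex A X' := ⟨_, _, h₁, h₂⟩
  have hs' := QbObjIso_naturality A hX' hX s
  have : IsIso ((Qb A).map (Kb.mkHom s hX' hX)) := by
    have : IsIso ((Qb A).map (Kb.mkHom s hX' hX)).hom := by
      rw [← Iso.eq_comp_inv, Category.assoc] at hs'
      rw [hs']
      infer_instance
    have : IsIso (Bounded.ι.map ((Qb A).map (Kb.mkHom s hX' hX))) := this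
    exact isIso_of_reflects_iso _ Bounded.ι
  refine ⟨_, Kb.mkHom s hX' hX, this, Kb.mkHom g hX' hY, ?_⟩
  rw [← cancel_epi ((Qb A).map (Kb.mkHom s hX' hX)), IsIso.hom_inv_id_assoc]
  ext1
  rw [← cancel_mono (QbObjIso A Y hY).hom, QbObjIso_naturality, ← IsIso.hom_inv_id_assoc (Q.map s)
    (Q.map g), ← fac, ← reassoc_of% hs', Iso.hom_inv_id_assoc]
  simp

end BoundedDerived

section FullSubcategory

variable {T : Type*} [Category* T] [HasZeroObject T] [HasShift T ℤ] [Preadditive T]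
  [∀ n : ℤ, (shiftFunctor T n).Additive] [Pretriangulated T]
  (P : ObjectProperty T) [P.IsTriangulated]

/-- A distinguished triangle whose objects belong to a triangulated subcategory is the image of
a distinguished triangle of this subcategory. -/
lemma exists_distinguished_lift (X : Triangle T) (hX : X ∈ distTriang T)
    (h₁ : P X.obj₁) (h₂ : P X.obj₂) (h₃ : P X.obj₃) :
    ∃ δ, Triangle.mk (ObjectProperty.homMk X.mor₁ : (⟨_, h₁⟩ : P.FullSubcategory) ⟶ ⟨_, h₂⟩)
      (ObjectProperty.homMk X.mor₂ : _ ⟶ (⟨_, h₃⟩ : P.FullSubcategory)) δ ∈ distTriang _ := by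
  refine ⟨ObjectProperty.homMk (X.mor₃ ≫ (P.ι.commShiftIso (1 : ℤ)).inv.app ⟨_, h₁⟩), ?_⟩
  rw [← P.ι.map_distinguished_iff]
  refine isomorphic_distinguished _ hX _
    (Triangle.isoMk _ _ (Iso.refl _) (Iso.refl _) (Iso.refl _) ?_ ?_ ?_)
  · exact (Category.comp_id _).trans (Category.id_comp _).symm
  · exact (Category.comp_id _).trans (Category.id_comp _).symm
  · have : (P.ι.commShiftIso (1 : ℤ)).inv.app ⟨X.obj₁, h₁⟩ ≫
        (P.ι.commShiftIso (1 : ℤ)).hom.app ⟨X.obj₁, h₁⟩ = 𝟙 _ :=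
      (P.ι.commShiftIso (1 : ℤ)).inv_hom_id_app _
    refine (congr_arg (_ ≫ ·) (CategoryTheory.Functor.map_id _ _)).trans ?_
    change ((X.mor₃ ≫ (P.ι.commShiftIso (1 : ℤ)).inv.app ⟨X.obj₁, h₁⟩) ≫
      (P.ι.commShiftIso (1 : ℤ)).hom.app ⟨X.obj₁, h₁⟩) ≫ 𝟙 _ = 𝟙 _ ≫ X.mor₃
    rw [Category.assoc X.mor₃, this]
    simp

end FullSubcategory

/-! ### Dévissage of bounded objects along their cohomology -/

section CohomologyDevissage

open DerivedCategory DerivedCategory.TStructure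

variable {A : Type u} [Category.{v} A] [Abelian A] [HasDerivedCategory.{w₁} A]

lemma prop_of_isGE_of_isLE (P : ObjectProperty (DerivedCategory A))
    [P.IsClosedUnderIsomorphisms] (X : DerivedCategory A) (n : ℤ) [X.IsGE n] [X.IsLE n]
    (h : P ((singleFunctor A n).obj ((homologyFunctor A n).obj X))) : P X := by
  obtain ⟨Y, ⟨e⟩⟩ := X.exists_iso_singleFunctor_obj_of_isGE_of_isLE n
  refine P.prop_of_iso ?_ h
  refine (singleFunctor A n).mapIso ?_ ≪≫ e.symm
  exact (homologyFunctor A n).mapIso e ≪≫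
    (homologyFunctor A n).mapIso ((singleFunctorIsoCompQ A n).app Y) ≪≫
    (homologyFunctorFactors A n).app _ ≪≫ (HomologicalComplex.homologyFunctorSingleIso A _ n).app Y

/-- Induction on the cohomological amplitude, splitting off the lowest cohomology by the truncation
triangle. Each cohomology object sits in its own degree, so closure under extensions suffices and
shifts are not needed. -/
lemma prop_of_prop_homology (P : ObjectProperty (DerivedCategory A)) [P.ContainsZero]
    [P.IsClosedUnderIsomorphisms] [P.IsTriangulatedClosed₂] (X : DerivedCategory A)
    (hX : (t : TStructure (DerivedCategory A)).bounded X)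
    (h : ∀ n, P ((singleFunctor A n).obj ((homologyFunctor A n).obj X))) : P X := by
  obtain ⟨⟨a, ha : X.IsGE a⟩, ⟨b, hb : X.IsLE b⟩⟩ := hX
  -- `toNat` allows `b < a`: the upper bound is then only weakened to `a`.
  replace hb : X.IsLE (a + (b - a).toNat) := t.isLE_of_le X b _ (by lia)
  generalize (b - a).toNat = k at hb
  induction k generalizing a X with
  | zero => 
    simp only [Nat.cast_zero, add_zero] at hb
    exact prop_of_isGE_of_isLE P X a (h a)
  | succ k hk =>
    obtain ⟨K, _, _, ⟨e⟩⟩ := exists_iso_Q_obj_of_isGE_of_isLE X a (a + (k + 1 : ℕ))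
    have eH (n : ℤ) : (homologyFunctor A n).obj X ≅ K.homology n :=
      (homologyFunctor A n).mapIso e ≪≫ (homologyFunctorFactors A n).app K
    have hT := triangleOfSES_distinguished (K.shortComplexTruncLE_shortExact a)
    refine P.prop_of_iso e.symm (P.ext_of_isTriangulatedClosed₂ _ hT ?_ ?_)
    · change P (Q.obj (K.truncLE a))
      refine prop_of_isGE_of_isLE P _ a (P.prop_of_iso ((singleFunctor A a).mapIso ?_) (h a))
      exact eH a ≪≫ (asIso (HomologicalComplex.homologyMap (K.ιTruncLE a) a)).symm ≪≫
        ((homologyFunctorFactors A a).app _).symm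
    · change P (Q.obj (K.shortComplexTruncLE a).X₃)
      refine P.prop_of_iso
        (asIso (Q.map (K.shortComplexTruncLEX₃ToTruncGE a (a + 1) rfl))).symm ?_
      refine hk _ (fun n => ?_) (a + 1) ?_ ?_
      · by_cases hn : a + 1 ≤ n
        · have : QuasiIsoAt (K.πTruncGE (a + 1)) n :=
            K.quasiIsoAt_πTruncGE _ _ hn
          refine P.prop_of_iso ((singleFunctor A n).mapIso ?_) (h n)
          exact eH n ≪≫ (asIso (HomologicalComplex.homologyMap (K.πTruncGE (a + 1)) n)) ≪≫
            ((homologyFunctorFactors A n).app _).symm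
        · exact P.prop_of_isZero (Functor.map_isZero _ (isZero_of_isGE _ (a + 1) n (by lia)))
      · infer_instance
      · rw [show a + 1 + (k : ℤ) = a + (k + 1 : ℕ) by push_cast; ring]
        infer_instance

/-- The objects of the derived category which belong to a given subcategory of `Dᵇ(A)`. -/
def boundedExtend (P : ObjectProperty (Bounded A)) : ObjectProperty (DerivedCategory A) :=
  fun X => ∃ hX, P ⟨X, hX⟩

variable (P : ObjectProperty (Bounded A))

instance [P.IsClosedUnderIsomorphisms] : (boundedExtend P).IsClosedUnderIsomorphisms where
  of_iso e := by
    rintro ⟨hX, h⟩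
    exact ⟨ObjectProperty.prop_of_iso _ e hX, P.prop_of_iso (Bounded.ι.preimageIso (X := ⟨_, hX⟩)
      (Y := ⟨_, ObjectProperty.prop_of_iso _ e hX⟩) e) h⟩

instance [P.IsStableUnderShift ℤ] [P.IsClosedUnderIsomorphisms] :
    (boundedExtend P).IsStableUnderShift ℤ where
  isStableUnderShiftBy n :=
    { le_shift := by
        rintro X ⟨hX, h⟩
        exact (boundedExtend P).prop_of_iso ((Bounded.ι.commShiftIso n).app ⟨X, hX⟩)
          ⟨_, P.le_shift n _ h⟩ }

instance [P.ContainsZero] [P.IsClosedUnderIsomorphisms] : (boundedExtend P).ContainsZero where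
  exists_zero := ⟨Bounded.ι.obj 0, Functor.map_isZero _ (isZero_zero _), ⟨_, P.prop_zero⟩⟩

instance [P.IsTriangulatedClosed₂] [P.IsClosedUnderIsomorphisms] :
    (boundedExtend P).IsTriangulatedClosed₂ :=
  .mk' fun T hT => by
    rintro ⟨h₁, hP₁⟩ ⟨h₃, hP₃⟩
    have h₂ : t.bounded T.obj₂ := ObjectProperty.ext_of_isTriangulatedClosed₂ _ T hT h₁ h₃
    obtain ⟨δ, hδ⟩ := exists_distinguished_lift _ T hT h₁ h₂ h₃
    exact ⟨h₂, P.ext_of_isTriangulatedClosed₂ _ hδ hP₁ hP₃⟩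

/-- A triangulated subcategory of `Dᵇ(A)` contains an object as soon as it contains its
cohomology objects. -/
lemma prop_of_prop_singleDb_homology [P.IsTriangulated] [P.IsClosedUnderIsomorphisms]
    (X : Bounded A) (h : ∀ n, P ((singleDb A).obj ((homologyFunctor A n).obj X.obj))) : P X := by
  -- The induction runs in the unbounded derived category; stability under shifts then moves the
  -- cohomology objects to degree `0`.
  refine (prop_of_prop_homology (boundedExtend P) X.obj X.property fun n => ?_).2
  refine (boundedExtend P).prop_of_iso (((singleFunctors A).shiftIso (-n) n 0 (by simp)).app _)
    ((boundedExtend P).le_shift (-n) _ ?_)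
  exact ⟨_, h n⟩

end CohomologyDevissage

/-! ### Full faithfulness of the functor to the derived category of `mod C` -/

section MapKb

variable {C : Type u} [Category.{v} C] [Preadditive C] {D : Type*} [Category* D] [Preadditive D]
  (F : C ⥤ D) [F.Additive]

instance [F.Full] [F.Faithful] : (mapKb F).Full :=
  inferInstanceAs ((isBoundedHomotopy D).lift (Kb.ι C ⋙ F.mapHomotopyCategory (.up ℤ)) _).Full

instance [F.Full] [F.Faithful] : (mapKb F).Faithful :=
  inferInstanceAs ((isBoundedHomotopy D).lift (Kb.ι C ⋙ F.mapHomotopyCategory (.up ℤ)) _).Faithful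

end MapKb

section YonedaDerived

open DerivedCategory DerivedCategory.TStructure

variable (C : Type u) [Category.{v} C] [Abelian C]

lemma isKProjective_map_yonedaMod (K : CochainComplex C ℤ) (hK : isBoundedComplex C K) :
    CochainComplex.IsKProjective (((yonedaMod C).mapHomologicalComplex (.up ℤ)).obj K) := by
  obtain ⟨a, b, _, _⟩ := hK
  have (n : ℤ) : Projective ((((yonedaMod C).mapHomologicalComplex (.up ℤ)).obj K).X n) :=
    projective_yonedaMod_obj _
  exact CochainComplex.isKProjective_of_projective _ b

variable [HasDerivedCategory.{w₂} (FinPresFunctor C)]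

/-- Maps out of a K-projective complex agree in the homotopy and derived categories, and Yoneda is
fully faithful on homotopy categories. -/
lemma yonedaDb_map_bijective (X Y : Kb C) :
    Function.Bijective ((yonedaDb C).map : (X ⟶ Y) → _) := by
  obtain ⟨K, hK, rfl⟩ := X.exists_eq_mk
  have := isKProjective_map_yonedaMod C K hK
  have h : Function.Bijective (Qh.map : (((mapKb (yonedaMod C)).obj (Kb.mk C K hK)).obj ⟶
      ((mapKb (yonedaMod C)).obj Y).obj) → _) :=
    CochainComplex.IsKProjective.Qh_map_bijective
      (((yonedaMod C).mapHomologicalComplex (.up ℤ)).obj K) _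
  constructor
  · intro f g hfg
    apply (mapKb (yonedaMod C)).map_injective
    ext1
    exact h.injective (congr_arg (·.hom) hfg)
  · intro φ
    obtain ⟨g, hg⟩ := h.surjective φ.hom
    obtain ⟨f, hf⟩ := (mapKb (yonedaMod C)).map_surjective (ObjectProperty.homMk g)
    refine ⟨f, ?_⟩
    ext1
    rw [← hg]
    exact congr_arg (fun k => Qh.map k.hom) hf

instance : (yonedaDb C).Full := ⟨fun {_ _} => (yonedaDb_map_bijective C _ _).surjective⟩

instance : (yonedaDb C).Faithful := ⟨fun {_ _ _ _} h => (yonedaDb_map_bijective C _ _).injective h⟩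

end YonedaDerived

/-- The connecting morphism is left existential, so its compatibility with shifts need not be
tracked. -/
lemma exists_distinguished_map {T D : Type*} [Category* T] [Category* D] [HasZeroObject T]
    [HasZeroObject D] [HasShift T ℤ] [HasShift D ℤ] [Preadditive T] [Preadditive D]
    [∀ n : ℤ, (shiftFunctor T n).Additive] [∀ n : ℤ, (shiftFunctor D n).Additive]
    [Pretriangulated T] [Pretriangulated D] (F : T ⥤ D) [F.CommShift ℤ] [F.IsTriangulated]
    {X Y Z : T} {f : X ⟶ Y} {g : Y ⟶ Z}
    (h : ∃ δ, Triangle.mk f g δ ∈ distTriang T) :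
    ∃ δ, Triangle.mk (F.map f) (F.map g) δ ∈ distTriang D := by
  obtain ⟨δ, hδ⟩ := h
  exact ⟨_, F.map_distinguished _ hδ⟩

/-! ### Three-term resolutions and essential surjectivity -/

section

open DerivedCategory DerivedCategory.TStructure

variable {A : Type u} [Category.{v} A] [Abelian A] [HasDerivedCategory.{w₁} A]

lemma exists_distinguished_singleDb {S : ShortComplex A} (hS : S.ShortExact) :
    ∃ δ, Triangle.mk ((singleDb A).map S.f) ((singleDb A).map S.g) δ ∈ distTriang (Bounded A) :=
  exists_distinguished_lift _ _ hS.singleTriangle_distinguished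
    ((singleDb A).obj _).property ((singleDb A).obj _).property ((singleDb A).obj _).property

/-- Negative extensions vanish by the t-structure; this gives the uniqueness of fill-ins used below.
-/
lemma singleDb_shift_hom_eq_zero {X Y : A}
    (f : ((singleDb A).obj X)⟦(1 : ℤ)⟧ ⟶ (singleDb A).obj Y) : f = 0 := by
  ext1
  have : IsLE (((singleDb A).obj X)⟦(1 : ℤ)⟧).obj (-1) := by
    have h0 : IsLE ((singleDb A).obj X).obj 0 :=
      inferInstanceAs (IsLE ((singleFunctor A 0).obj X) 0)
    have : IsLE (((singleDb A).obj X).obj⟦(1 : ℤ)⟧) (-1) := t.isLE_shift _ 0 1 (-1) (by simp)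
    exact t.isLE_of_iso (show ((singleDb A).obj X).obj⟦(1 : ℤ)⟧ ≅ _ from
      (Bounded.ι.commShiftIso (1 : ℤ)).symm.app ((singleDb A).obj X)) (-1)
  have : IsGE ((singleDb A).obj Y).obj 0 :=
    inferInstanceAs (IsGE ((singleFunctor A 0).obj Y) 0)
  exact t.zero f.hom (-1) 0 (by simp)

/-- The class in `Dᵇ(A)` of an object with a three-term resolution. -/
lemma nonempty_iso_singleDb_of_resolution {S₁ S₂ : ShortComplex A} (h₁ : S₁.ShortExact)
    (h₂ : S₂.ShortExact) (e : S₁.X₃ ≅ S₂.X₁) {a b c m₁ m : Bounded A} {i : a ⟶ b} {q : b ⟶ m₁}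
    {δ₁ : m₁ ⟶ a⟦(1 : ℤ)⟧} {r : m₁ ⟶ c} {s : c ⟶ m} {δ₂ : m ⟶ m₁⟦(1 : ℤ)⟧}
    (hT₁ : Triangle.mk i q δ₁ ∈ distTriang _) (hT₂ : Triangle.mk r s δ₂ ∈ distTriang _)
    (ea : a ≅ (singleDb A).obj S₁.X₁) (eb : b ≅ (singleDb A).obj S₁.X₂)
    (ec : c ≅ (singleDb A).obj S₂.X₂) (hi : i ≫ eb.hom = ea.hom ≫ (singleDb A).map S₁.f)
    (hqr : (q ≫ r) ≫ ec.hom = eb.hom ≫ (singleDb A).map (S₁.g ≫ e.hom ≫ S₂.f)) :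
    Nonempty (m ≅ (singleDb A).obj S₂.X₃) := by
  obtain ⟨d₁, hd₁⟩ := exists_distinguished_singleDb h₁
  obtain ⟨d₂, hd₂⟩ := exists_distinguished_singleDb h₂
  let e₁ := isoTriangleOfIso₁₂ _ _ hT₁ hd₁ ea eb hi
  let e₃ : m₁ ≅ (singleDb A).obj S₁.X₃ := Triangle.π₃.mapIso e₁
  have he₃ : q ≫ e₃.hom = eb.hom ≫ (singleDb A).map S₁.g :=
    e₁.hom.comm₂
  -- Both sides agree after composition with `q`, so they differ by a map through `δ₁`, that is, by
  -- a negative extension, which is zero.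
  have key : r ≫ ec.hom = (e₃ ≪≫ (singleDb A).mapIso e).hom ≫ (singleDb A).map S₂.f := by
    rw [← sub_eq_zero]
    obtain ⟨h, hh⟩ : ∃ h : a⟦(1 : ℤ)⟧ ⟶ (singleDb A).obj S₂.X₂, 
        r ≫ ec.hom - (e₃ ≪≫ (singleDb A).mapIso e).hom ≫ (singleDb A).map S₂.f = δ₁ ≫ h :=
      Triangle.yoneda_exact₃ _ hT₁ _ (show q ≫ _ = 0 by
        rw [Preadditive.comp_sub, ← Category.assoc, hqr, Iso.trans_hom, Category.assoc,
          reassoc_of% he₃, Functor.mapIso_hom, Functor.map_comp, Functor.map_comp, sub_self])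
    rw [hh]
    have : h = (ea.hom⟦1⟧') ≫ (ea.inv⟦1⟧') ≫ h := by
      rw [← Functor.map_comp_assoc, Iso.hom_inv_id, CategoryTheory.Functor.map_id, Category.id_comp]
    rw [this, singleDb_shift_hom_eq_zero (_ ≫ h), comp_zero, comp_zero]
  exact ⟨Triangle.π₃.mapIso
    (isoTriangleOfIso₁₂ _ _ hT₂ hd₂ (e₃ ≪≫ (singleDb A).mapIso e) ec key)⟩

end

section

variable (C : Type u) [Category.{v} C] [Abelian C] 

/-- The functor `C ⥤ Kᵇ(C)` sending an object to the complex concentrated in degree `0`. -/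
noncomputable def singleKb : C ⥤ Kb C :=
  (isBoundedHomotopy C).lift
    (HomologicalComplex.single C (.up ℤ) 0 ⋙ HomotopyCategory.quotient C (.up ℤ))
    (fun _ => (isBoundedHomotopy_quotient_obj_iff _).2 ⟨0, 0, inferInstance, inferInstance⟩)

variable [HasDerivedCategory.{w₂} (FinPresFunctor C)]
open DerivedCategory

/-- The functor `Kᵇ(C) ⥤ Dᵇ(mod C)` extends the Yoneda functor. -/
noncomputable def singleKbCompYonedaDbIso :
    singleKb C ⋙ yonedaDb C ≅ yonedaMod C ⋙ singleDb (FinPresFunctor C) :=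
  ((ObjectProperty.fullyFaithfulι _).whiskeringRight _).preimageIso
    (Functor.isoWhiskerRight (HomologicalComplex.singleMapHomologicalComplex
      (yonedaMod C) (.up ℤ) 0) (HomotopyCategory.quotient _ _ ⋙ Qh) ≪≫
      Functor.isoWhiskerLeft (yonedaMod C ⋙ HomologicalComplex.single _ (.up ℤ) 0)
        (quotientCompQhIso (FinPresFunctor C)) ≪≫
      (Functor.isoWhiskerLeft (yonedaMod C) (singleFunctorIsoCompQ (FinPresFunctor C) 0).symm))

end

section

variable {C : Type u} [Category.{v} C] [Preadditive C] [HasZeroObject C] [HasBinaryBiproducts C]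

lemma exists_distinguished_mappingCone {K L : CochainComplex C ℤ} (f : K ⟶ L)
    (hK : isBoundedComplex C K) (hL : isBoundedComplex C L)
    (hf : isBoundedComplex C (CochainComplex.mappingCone f)) :
    ∃ δ, Triangle.mk (Kb.mkHom f hK hL) (Kb.mkHom (CochainComplex.mappingCone.inr f) hL hf) δ ∈
      distTriang (Kb C) :=
  exists_distinguished_lift _ _ (HomotopyCategory.mappingCone_triangleh_distinguished f)
    (Kb.mk C K hK).property (Kb.mk C L hL).property (Kb.mk C _ hf).property

end

section

variable {C : Type u} [Category.{v} C] [Abelian C] [HasDerivedCategory.{w₂} (FinPresFunctor C)]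

open DerivedCategory CochainComplex

/-- A presentation of `F` by `f` gives a complex `ker f ⟶ X ⟶ Y` whose image in `Dᵇ(mod C)`
is `F`. -/
lemma exists_yonedaDb_obj_iso_singleDb {X Y : C} {f : X ⟶ Y} {F : FinPresFunctor C}
    (hf : IsPresentedBy f F.obj) :
    ∃ (M : CochainComplex C ℤ) (hM : isBoundedComplex C M), M.IsStrictlyGE (-2) ∧
      M.IsStrictlyLE 0 ∧
      Nonempty ((yonedaDb C).obj (Kb.mk C M hM) ≅ (singleDb (FinPresFunctor C)).obj F) := by
  obtain ⟨p, w, ⟨hp⟩⟩ := hf.exists_isColimit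
  have : Epi p := Cofork.IsColimit.epi hp
  let S := HomologicalComplex.single C (.up ℤ) 0
  have hS (Z : C) : isBoundedComplex C (S.obj Z) := ⟨0, 0, inferInstance, inferInstance⟩
  let ι := S.map (kernel.ι f)
  -- The cone of `ι` is `ker f ⟶ X` in degrees `-1, 0`, so the cone of `φ` is `ker f ⟶ X ⟶ Y` in
  -- degrees `-2, -1, 0`, up to signs.
  let φ : mappingCone ι ⟶ S.obj Y := mappingCone.desc ι 0 (S.map f) (by
    simp [ι, ← Functor.map_comp])
  have hφ : mappingCone.inr ι ≫ φ = S.map f := by simp [φ]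
  have g₁ : (mappingCone ι).IsStrictlyGE (-1) :=
    isStrictlyGE_mappingCone ι 0 0 _ (by simp) (by simp)
  have l₁ : (mappingCone ι).IsStrictlyLE 0 :=
    isStrictlyLE_mappingCone C ι 0 0 _ (by simp) (by simp)
  have g₂ : (mappingCone φ).IsStrictlyGE (-2) :=
    isStrictlyGE_mappingCone φ (-1) 0 _ (by simp) (by simp)
  have l₂ : (mappingCone φ).IsStrictlyLE 0 :=
    isStrictlyLE_mappingCone C φ 0 0 _ (by simp) (by simp)
  have hM₁ : isBoundedComplex C (mappingCone ι) := ⟨_, _, g₁, l₁⟩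
  have hM : isBoundedComplex C (mappingCone φ) := ⟨_, _, g₂, l₂⟩
  refine ⟨mappingCone φ, hM, g₂, l₂, ?_⟩
  obtain ⟨δ₁, hT₁⟩ := exists_distinguished_map (yonedaDb C) <|
    exists_distinguished_mappingCone ι (hS _) (hS _) hM₁
  obtain ⟨δ₂, hT₂⟩ := exists_distinguished_map (yonedaDb C) <|
    exists_distinguished_mappingCone φ hM₁ (hS _) hM
  let y := yonedaMod C
  -- The resolution of `F` is cut at `ker p` into two short exact sequences, matching the two cones.
  let S₁ : ShortComplex (FinPresFunctor C) := ShortComplex.mk (y.map (kernel.ι f))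
    (kernel.lift p (y.map f) w) (by
      rw [← cancel_mono (kernel.ι p), Category.assoc, kernel.lift_ι, ← y.map_comp,
        kernel.condition, Functor.map_zero, zero_comp])
  have h₁ : S₁.ShortExact := by
    have : y.IsRightAdjoint := inferInstanceAs (yonedaMod C).IsRightAdjoint
    have : PreservesLimits y := (Adjunction.ofIsRightAdjoint y).rightAdjoint_preservesLimits
    -- Replacing `ker p` by the larger `Hom(-, Y)` does not affect exactness in the middle, which
    -- then follows from left exactness of Yoneda.
    let α : S₁ ⟶ (ShortComplex.mk (kernel.ι f) f (kernel.condition f)).map y :=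
      { τ₁ := 𝟙 _, τ₂ := 𝟙 _, τ₃ := kernel.ι p
        comm₁₂ := (Category.id_comp _).trans (Category.comp_id _).symm
        comm₂₃ := (Category.id_comp _).trans (kernel.lift_ι _ _ _).symm }
    have : Epi α.τ₁ := inferInstanceAs (Epi (𝟙 _))
    have : IsIso α.τ₂ := inferInstanceAs (IsIso (𝟙 _))
    have : Mono α.τ₃ := inferInstanceAs (Mono (kernel.ι p))
    exact
      { mono_f := inferInstanceAs (Mono (y.map (kernel.ι f)))
        epi_g := (ShortComplex.exact_iff_epi_kernel_lift (ShortComplex.mk _ p w)).1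
          (ShortComplex.exact_of_g_is_cokernel _ hp)
        exact := (ShortComplex.exact_iff_of_epi_of_isIso_of_mono α).2
          ((ShortComplex.exact_kernel f).map_of_mono_of_preservesKernel y inferInstance
            inferInstance) }
  let S₂ : ShortComplex (FinPresFunctor C) := ShortComplex.mk (kernel.ι p) p (kernel.condition p)
  have h₂ : S₂.ShortExact := { exact := ShortComplex.exact_kernel p }
  let E (Z : C) : (yonedaDb C).obj (Kb.mk C (S.obj Z) (hS Z)) ≅
      (singleDb (FinPresFunctor C)).obj (y.obj Z) := (singleKbCompYonedaDbIso C).app Z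
  have hE {Z Z' : C} (k : Z ⟶ Z') : (yonedaDb C).map (Kb.mkHom (S.map k) (hS Z) (hS Z')) ≫
      (E Z').hom = (E Z).hom ≫ (singleDb (FinPresFunctor C)).map (y.map k) :=
    (singleKbCompYonedaDbIso C).hom.naturality k
  refine nonempty_iso_singleDb_of_resolution h₁ h₂ (Iso.refl _) hT₁ hT₂
    (E _) (E _) (E _) (hE (kernel.ι f)) ?_
  have hcomp : Kb.mkHom (mappingCone.inr ι) (hS X) hM₁ ≫ Kb.mkHom φ hM₁ (hS Y) =
      Kb.mkHom (S.map f) (hS X) (hS Y) := by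
    rw [← hφ]
    ext1
    exact ((HomotopyCategory.quotient C (.up ℤ)).map_comp _ _).symm
  rw [← Functor.map_comp, hcomp, hE]
  have : S₁.g ≫ (Iso.refl S₁.X₃).hom ≫ S₂.f = y.map f :=
    (congr_arg (S₁.g ≫ ·) (Category.id_comp S₂.f)).trans (kernel.lift_ι p (y.map f) w)
  exact congr_arg (fun k => (E X).hom ≫ (singleDb (FinPresFunctor C)).map k) this.symm

/-- The essential image of a full triangulated functor is triangulated; it contains `mod C`, hence
everything by dévissage. -/
instance : (yonedaDb C).EssSurj where
  mem_essImage X := prop_of_prop_singleDb_homology (yonedaDb C).essImage X fun n => by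
    obtain ⟨X, Y, f, hf⟩ := ((homologyFunctor (FinPresFunctor C) n).obj X.obj).property
    obtain ⟨M, hM, -, -, ⟨e⟩⟩ := exists_yonedaDb_obj_iso_singleDb hf
    exact ⟨_, ⟨e⟩⟩

instance : (yonedaDb C).IsEquivalence where

end

/-! ### Isomorphisms of functors commuting with shifts -/

section ShiftIso

variable {C D E : Type*} [Category* C] [Category* D] [Category* E]
  [HasShift C ℤ] [HasShift D ℤ] [HasShift E ℤ]

/-- Two functors are isomorphic as functors commuting with shifts. -/
def ShiftIso (F G : C ⥤ D) [F.CommShift ℤ] [G.CommShift ℤ] : Prop :=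
  ∃ α : F ≅ G, NatTrans.CommShift α.hom ℤ

namespace ShiftIso

variable {F G H : C ⥤ D} [F.CommShift ℤ] [G.CommShift ℤ] [H.CommShift ℤ]

lemma symm (h : ShiftIso F G) : ShiftIso G F := by
  obtain ⟨α, _⟩ := h
  exact ⟨α.symm, inferInstance⟩

lemma trans (h : ShiftIso F G) (h' : ShiftIso G H) : ShiftIso F H := by
  obtain ⟨α, _⟩ := h
  obtain ⟨β, _⟩ := h'
  exact ⟨α ≪≫ β, inferInstanceAs (NatTrans.CommShift (α.hom ≫ β.hom) ℤ)⟩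

lemma whiskerRight (h : ShiftIso F G) (K : D ⥤ E) [K.CommShift ℤ] :
    ShiftIso (F ⋙ K) (G ⋙ K) := by
  obtain ⟨α, _⟩ := h
  exact ⟨Functor.isoWhiskerRight α K,
    inferInstanceAs (NatTrans.CommShift (Functor.whiskerRight α.hom K) ℤ)⟩

lemma whiskerLeft (h : ShiftIso F G) (K : E ⥤ C) [K.CommShift ℤ] :
    ShiftIso (K ⋙ F) (K ⋙ G) := by
  obtain ⟨α, _⟩ := h
  exact ⟨Functor.isoWhiskerLeft K α,
    inferInstanceAs (NatTrans.CommShift (Functor.whiskerLeft K α.hom) ℤ)⟩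

lemma assoc {E' : Type*} [Category* E'] [HasShift E' ℤ] (F : C ⥤ D) (G : D ⥤ E) (H : E ⥤ E')
    [F.CommShift ℤ] [G.CommShift ℤ] [H.CommShift ℤ] : ShiftIso ((F ⋙ G) ⋙ H) (F ⋙ G ⋙ H) :=
  ⟨Functor.associator F G H, inferInstance⟩

lemma leftUnitor (F : C ⥤ D) [F.CommShift ℤ] : ShiftIso (𝟭 C ⋙ F) F :=
  ⟨F.leftUnitor, inferInstance⟩

lemma rightUnitor (F : C ⥤ D) [F.CommShift ℤ] : ShiftIso (F ⋙ 𝟭 D) F :=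
  ⟨F.rightUnitor, inferInstance⟩

/-- A fully faithful functor reflects isomorphisms of functors commuting with shifts. -/
lemma of_comp (K : D ⥤ E) [K.CommShift ℤ] [K.Full] [K.Faithful]
    (h : ShiftIso (F ⋙ K) (G ⋙ K)) : ShiftIso F G := by
  obtain ⟨α, _⟩ := h
  let β : F ≅ G := ((Functor.FullyFaithful.ofFullyFaithful K).whiskeringRight C).preimageIso α
  have hβ (X : C) : K.map (β.hom.app X) = α.hom.app X :=
    (Functor.FullyFaithful.ofFullyFaithful K).map_preimage _
  refine ⟨β, ⟨fun n => ?_⟩⟩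
  ext X
  apply K.map_injective
  have h1 := NatTrans.shift_app_comm α.hom n X
  rw [Functor.commShiftIso_comp_hom_app, Functor.commShiftIso_comp_hom_app, ← hβ, ← hβ,
    Category.assoc, ← Functor.commShiftIso_hom_naturality, ← K.map_comp_assoc,
    ← K.map_comp_assoc, cancel_mono] at h1
  exact h1

end ShiftIso

/-- Isomorphisms of functors commuting with shifts descend to the homotopy category. -/
lemma ShiftIso.of_quotient_comp {A : Type*} [Category* A] [Preadditive A]
    {F G : HomotopyCategory A (.up ℤ) ⥤ D} [F.CommShift ℤ] [G.CommShift ℤ]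
    (h : ShiftIso (HomotopyCategory.quotient A (.up ℤ) ⋙ F)
      (HomotopyCategory.quotient A (.up ℤ) ⋙ G)) : ShiftIso F G := by
  obtain ⟨α, _⟩ := h
  let β : F ≅ G := Quotient.natIsoLift _ α
  refine ⟨β, ⟨fun n => ?_⟩⟩
  ext X
  obtain ⟨K : CochainComplex A ℤ, rfl⟩ := HomotopyCategory.quotient_obj_surjective X
  have h1 := NatTrans.shift_app_comm α.hom n K
  rw [Functor.commShiftIso_comp_hom_app, Functor.commShiftIso_comp_hom_app, Category.assoc] at h1
  have h2 : F.map (((HomotopyCategory.quotient A (.up ℤ)).commShiftIso n).hom.app K) ≫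
      β.hom.app (((HomotopyCategory.quotient A (.up ℤ)).obj K)⟦n⟧) = 
      α.hom.app (K⟦n⟧) ≫ G.map (((HomotopyCategory.quotient A (.up ℤ)).commShiftIso n).hom.app K) :=
    β.hom.naturality (((HomotopyCategory.quotient A (.up ℤ)).commShiftIso n).hom.app K)
  rw [← reassoc_of% h2, cancel_epi] at h1
  exact h1

end ShiftIso

section

variable {A : Type*} [Category* A] [Preadditive A] {B : Type*} [Category* B] [Preadditive B]
  (F : A ⥤ B) [F.Additive] (G : B ⥤ A) [G.Additive]

lemma shiftIso_mapHomologicalComplex (e : F ⋙ G ≅ 𝟭 A) :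
    ShiftIso (F.mapHomologicalComplex (.up ℤ) ⋙ G.mapHomologicalComplex (.up ℤ))
      (𝟭 (CochainComplex A ℤ)) := by
  refine ⟨Functor.mapHomologicalComplexCompIso e (.up ℤ) ≪≫
    Functor.mapHomologicalComplexIdIso A (.up ℤ), ⟨fun n => ?_⟩⟩
  ext K i
  simp [Functor.commShiftIso_comp_hom_app]
  exact (congr_arg (· ≫ _) (G.map_id _)).trans
    ((Category.id_comp _).trans (Category.id_comp (e.hom.app (K.X (i + n)) ≫ 𝟙 _)))

lemma shiftIso_mapHomotopyCategory (e : F ⋙ G ≅ 𝟭 A) :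
    ShiftIso (F.mapHomotopyCategory (.up ℤ) ⋙ G.mapHomotopyCategory (.up ℤ))
      (𝟭 (HomotopyCategory A (.up ℤ))) := by
  have hF : ShiftIso (HomotopyCategory.quotient A (.up ℤ) ⋙ F.mapHomotopyCategory (.up ℤ))
      (F.mapHomologicalComplex (.up ℤ) ⋙ HomotopyCategory.quotient B (.up ℤ)) :=
    ⟨F.mapHomotopyCategoryFactors (.up ℤ), inferInstance⟩
  have hG : ShiftIso (HomotopyCategory.quotient B (.up ℤ) ⋙ G.mapHomotopyCategory (.up ℤ))
      (G.mapHomologicalComplex (.up ℤ) ⋙ HomotopyCategory.quotient A (.up ℤ)) :=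
    ⟨G.mapHomotopyCategoryFactors (.up ℤ), inferInstance⟩
  refine .of_quotient_comp ?_
  exact (ShiftIso.assoc _ _ _).symm.trans ((hF.whiskerRight _).trans ((ShiftIso.assoc _ _ _).trans
    ((hG.whiskerLeft _).trans ((ShiftIso.assoc _ _ _).symm.trans
    (((shiftIso_mapHomologicalComplex F G e).whiskerRight _).trans
    ((ShiftIso.leftUnitor _).trans (ShiftIso.rightUnitor _).symm))))))

lemma shiftIso_mapKb_comp_ι : ShiftIso (mapKb F ⋙ Kb.ι B) (Kb.ι A ⋙ F.mapHomotopyCategory (.up ℤ)) :=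
  ⟨(isBoundedHomotopy B).liftCompιIso _ _,
    inferInstanceAs (NatTrans.CommShift ((isBoundedHomotopy B).liftCompιIso
      (Kb.ι A ⋙ F.mapHomotopyCategory (.up ℤ)) _).hom ℤ)⟩

lemma shiftIso_mapKb_comp_mapKb (e : F ⋙ G ≅ 𝟭 A) : ShiftIso (mapKb F ⋙ mapKb G) (𝟭 (Kb A)) := by
  refine .of_comp (Kb.ι A) ?_
  exact (ShiftIso.assoc _ _ _).trans (((shiftIso_mapKb_comp_ι G).whiskerLeft _).trans
    ((ShiftIso.assoc _ _ _).symm.trans (((shiftIso_mapKb_comp_ι F).whiskerRight _).trans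
    ((ShiftIso.assoc _ _ _).trans (((shiftIso_mapHomotopyCategory F G e).whiskerLeft _).trans
    ((ShiftIso.rightUnitor _).trans (ShiftIso.leftUnitor _).symm))))))

end

section

open DerivedCategory DerivedCategory.TStructure

variable (A : Type u) [Category.{v} A] [Abelian A] [HasDerivedCategory.{w₁} A]

lemma shiftIso_Qb_comp_ι : ShiftIso (Qb A ⋙ Bounded.ι) (Kb.ι A ⋙ Qh) :=
  ⟨t.bounded.liftCompιIso _ _, inferInstanceAs (NatTrans.CommShift
    (t.bounded.liftCompιIso (Kb.ι A ⋙ Qh) _).hom ℤ)⟩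

variable {A} {B : Type*} [Category* B] [Abelian B] [HasDerivedCategory.{w₂} B]
  (F : A ⥤ B) [F.Additive] [PreservesFiniteLimits F] [PreservesFiniteColimits F]

lemma shiftIso_mapDb_comp_ι : ShiftIso (mapDb F ⋙ Bounded.ι) (Bounded.ι ⋙ F.mapDerivedCategory) :=
  ⟨t.bounded.liftCompιIso _ _, inferInstanceAs (NatTrans.CommShift
    (t.bounded.liftCompιIso (Bounded.ι ⋙ F.mapDerivedCategory) _).hom ℤ)⟩

/-- The inclusion into the unbounded derived category reflects such isomorphisms, and after it both
sides become `F` on complexes followed by `Qh`. -/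
lemma shiftIso_Qb_comp_mapDb : ShiftIso (Qb A ⋙ mapDb F) (mapKb F ⋙ Qb B) := by
  refine .of_comp Bounded.ι ?_
  have h : ShiftIso (Qh ⋙ F.mapDerivedCategory) (F.mapHomotopyCategory (.up ℤ) ⋙ Qh) :=
    ⟨F.mapDerivedCategoryFactorsh, inferInstance⟩
  have h₁ : ShiftIso ((Qb A ⋙ mapDb F) ⋙ Bounded.ι)
      (Kb.ι A ⋙ F.mapHomotopyCategory (.up ℤ) ⋙ Qh) :=
    (ShiftIso.assoc _ _ _).trans (((shiftIso_mapDb_comp_ι F).whiskerLeft _).trans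
      ((ShiftIso.assoc _ _ _).symm.trans (((shiftIso_Qb_comp_ι A).whiskerRight _).trans
      ((ShiftIso.assoc _ _ _).trans (h.whiskerLeft _)))))
  have h₂ : ShiftIso ((mapKb F ⋙ Qb B) ⋙ Bounded.ι)
      (Kb.ι A ⋙ F.mapHomotopyCategory (.up ℤ) ⋙ Qh) :=
    (ShiftIso.assoc _ _ _).trans (((shiftIso_Qb_comp_ι B).whiskerLeft _).trans
      ((ShiftIso.assoc _ _ _).symm.trans (((shiftIso_mapKb_comp_ι F).whiskerRight _).trans
      (ShiftIso.assoc _ _ _))))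
  exact h₁.trans h₂.symm

end

section

variable (C : Type u) [Category.{v} C] [Abelian C] [HasDerivedCategory.{w₁} C]
  [HasDerivedCategory.{w₂} (FinPresFunctor C)]

/-- Exactness lets the adjoint be applied degreewise before localizing, where it cancels the Yoneda
functor. -/
lemma shiftIso_yonedaDb_comp_mapDb :
    ShiftIso (yonedaDb C ⋙ mapDb (yonedaModLeftAdjoint C)) (Qb C) :=
  (ShiftIso.assoc (mapKb (yonedaMod C)) (Qb _) _).trans
    (((shiftIso_Qb_comp_mapDb (yonedaModLeftAdjoint C)).whiskerLeft _).trans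
    ((ShiftIso.assoc _ _ _).symm.trans (((shiftIso_mapKb_comp_mapKb _ _
    yonedaModCompLeftAdjointIso).whiskerRight _).trans (ShiftIso.leftUnitor _))))

end

/-! ### Kernels of triangulated functors are thick -/

section Kernel

variable {T D : Type*} [Category* T] [Category* D] [HasZeroObject T] [HasZeroObject D]
  [HasShift T ℤ] [HasShift D ℤ] [Preadditive T] [Preadditive D]
  [∀ n : ℤ, (shiftFunctor T n).Additive] [∀ n : ℤ, (shiftFunctor D n).Additive]
  [Pretriangulated T] [Pretriangulated D] (F : T ⥤ D) [F.CommShift ℤ] [F.IsTriangulated]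

instance : F.kernel.IsTriangulated where
  isStableUnderShiftBy n :=
    { le_shift := fun X (hX : IsZero (F.obj X)) =>
        ((shiftFunctor D n).map_isZero hX).of_iso ((F.commShiftIso n).app X) }
  toIsTriangulatedClosed₂ := .mk' fun _ hX h₁ h₃ =>
    Triangle.isZero₂_of_isZero₁₃ _ (F.map_distinguished _ hX) h₁ h₃

instance : F.kernel.IsStableUnderRetracts where
  of_retract {X Y} r (hY : IsZero (F.obj Y)) := by
    refine (IsZero.iff_id_eq_zero _).2 ?_
    rw [← F.map_id, ← r.retract, F.map_comp, hY.eq_of_tgt (F.map r.i) 0, zero_comp]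

end Kernel

section

open DerivedCategory DerivedCategory.TStructure

variable {A : Type u} [Category.{v} A] [Abelian A] [HasDerivedCategory.{w₁} A]
  {B : Type*} [Category* B] [Abelian B] [HasDerivedCategory.{w₂} B]
  (F : A ⥤ B) [F.Additive] [PreservesFiniteLimits F] [PreservesFiniteColimits F]

/-- The functor induced by an exact functor on bounded derived categories extends it. -/
noncomputable def singleDbCompMapDbIso : singleDb A ⋙ mapDb F ≅ F ⋙ singleDb B :=
  ((ObjectProperty.fullyFaithfulι _).whiskeringRight _).preimageIso
    (F.mapDerivedCategorySingleFunctor 0)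

/-- An exact functor commutes with cohomology. -/
lemma isZero_obj_homology_of_isZero_mapDb (X : Bounded A) (hX : IsZero ((mapDb F).obj X)) (n : ℤ) :
    IsZero (F.obj ((homologyFunctor A n).obj X.obj)) := by
  rw [isZero_bounded_iff] at hX
  replace hX : IsZero (F.mapDerivedCategory.obj X.obj) := hX
  let K := Q.objPreimage X.obj
  let e : Q.obj K ≅ X.obj := Q.objObjPreimageIso X.obj
  let FK := (F.mapHomologicalComplex (.up ℤ)).obj K
  have h : IsZero (FK.homology n) :=
    ((homologyFunctor B n).map_isZero hX).of_iso
      (((homologyFunctorFactors B n).app FK).symm ≪≫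
      (homologyFunctor B n).mapIso ((F.mapDerivedCategoryFactors.app K).symm ≪≫
        F.mapDerivedCategory.mapIso e))
  refine h.of_iso (F.mapIso ((homologyFunctor A n).mapIso e.symm ≪≫
    (homologyFunctorFactors A n).app K) ≪≫ ((K.sc n).mapHomologyIso F).symm)

lemma isZero_singleDb_obj {X : A} (hX : IsZero X) : IsZero ((singleDb A).obj X) := by
  rw [isZero_bounded_iff]
  exact (singleFunctor A 0).map_isZero hX

end

/-! ### Acyclic complexes, `Thick(eff C)` and generation -/

section

open DerivedCategory

variable (C : Type u) [Category.{v} C] [Abelian C] [HasDerivedCategory.{w₁} C]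
  [HasDerivedCategory.{w₂} (FinPresFunctor C)]

lemma isZero_mapDb_yonedaDb_iff (X : Kb C) :
    IsZero ((mapDb (yonedaModLeftAdjoint C)).obj ((yonedaDb C).obj X)) ↔ isAcyclicKb C X := by
  obtain ⟨α, -⟩ := shiftIso_yonedaDb_comp_mapDb C
  rw [isAcyclicKb_iff_isZero]
  exact (α.app X).isZero_iff

lemma isZero_mapDb_singleDb {F : FinPresFunctor C} (hF : isEffaceable C F) :
    IsZero ((mapDb (yonedaModLeftAdjoint C)).obj ((singleDb _).obj F)) :=
  (isZero_singleDb_obj ((isEffaceable_iff_isZero F).1 hF)).of_iso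
    ((singleDbCompMapDbIso (yonedaModLeftAdjoint C)).app F)

lemma isEffaceable_homology (Y : Bounded (FinPresFunctor C))
    (hY : IsZero ((mapDb (yonedaModLeftAdjoint C)).obj Y)) (n : ℤ) :
    isEffaceable C ((homologyFunctor (FinPresFunctor C) n).obj Y.obj) :=
  (isEffaceable_iff_isZero _).2 (isZero_obj_homology_of_isZero_mapDb _ Y hY n)

/-- The kernel is thick and contains `eff C`. Conversely an object of the kernel has effaceable
cohomology, from which dévissage rebuilds it. -/
lemma thickEff_iff_isZero (Y : Bounded (FinPresFunctor C)) :
    thickEff C Y ↔ IsZero ((mapDb (yonedaModLeftAdjoint C)).obj Y) := by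
  constructor
  · suffices thickEff C ≤ (mapDb (yonedaModLeftAdjoint C)).kernel from this Y
    refine (ObjectProperty.triangEnvelope_le_iff _).2 ?_
    rintro Y ⟨F, hF, ⟨e⟩⟩
    exact (isZero_mapDb_singleDb C hF).of_iso ((mapDb (yonedaModLeftAdjoint C)).mapIso e.symm)
  · intro hY
    have : (thickEff C).IsClosedUnderIsomorphisms := by
      dsimp only [thickEff]
      infer_instance
    exact prop_of_prop_singleDb_homology _ Y fun n => ObjectProperty.le_triangEnvelope _ _
      ⟨_, isEffaceable_homology C Y hY n, ⟨Iso.refl _⟩⟩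

lemma isAcyclicKb_eq_inverseImage : isAcyclicKb C = (thickEff C).inverseImage (yonedaDb C) := by
  ext X
  exact (isZero_mapDb_yonedaDb_iff C X).symm.trans (thickEff_iff_isZero C _).symm

/-- Dévissage is applied to the image of `P` under the equivalence `yonedaDb`, since the cohomology
to be used is that in `mod C`, not the vanishing one in `C`. -/
lemma isAcyclicKb_le_of_isShortAcyclicKb_le (P : ObjectProperty (Kb C)) [P.IsTriangulated]
    [P.IsClosedUnderIsomorphisms] (hP : isShortAcyclicKb C ≤ P) : isAcyclicKb C ≤ P := by
  intro X hX
  rw [← isZero_mapDb_yonedaDb_iff] at hX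
  obtain ⟨Z, hZ, ⟨e⟩⟩ : P.map (yonedaDb C) ((yonedaDb C).obj X) := by
    refine prop_of_prop_singleDb_homology _ _ fun n => ?_
    obtain ⟨X', Y, f, hf, hF⟩ := isEffaceable_homology C _ hX n
    obtain ⟨M, hM, h₁, h₂, ⟨e⟩⟩ := exists_yonedaDb_obj_iso_singleDb hF
    -- The complex occupies degrees `-2` to `0`, so its middle degree is `-1`.
    have h₁' : M.IsStrictlyGE (-1 - 1) := by norm_num; exact h₁
    have h₂' : M.IsStrictlyLE (-1 + 1) := by norm_num; exact h₂
    refine ⟨Kb.mk C M hM, hP _ ⟨?_, -1, h₁', h₂'⟩, ⟨e⟩⟩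
    rw [← isZero_mapDb_yonedaDb_iff]
    exact (isZero_mapDb_singleDb C ⟨X', Y, f, hf, hF⟩).of_iso ((mapDb _).mapIso e)
  exact P.prop_of_iso ((yonedaDb C).preimageIso e) hZ

lemma triangEnvelope_isShortAcyclicKb : (isShortAcyclicKb C).triangEnvelope = isAcyclicKb C := by
  have : isAcyclicKb C = (Qb C).kernel := by
    ext X
    exact isAcyclicKb_iff_isZero C X
  have : (isAcyclicKb C).IsStableUnderRetracts := by
    rw [this]
    infer_instance
  -- A nonempty generating class ensures that the envelope is triangulated.
  have : (isShortAcyclicKb C).Nonempty := by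
    have h₀ : IsZero (Kb.mk C 0 ⟨0, 0, inferInstance, inferInstance⟩) :=
      IsZero.of_full_of_faithful_of_isZero (Kb.ι C) _
        ((HomotopyCategory.quotient _ _).map_isZero (isZero_zero _))
    exact ⟨_, (isAcyclicKb C).prop_of_isZero h₀, 0,
      inferInstanceAs ((0 : CochainComplex C ℤ).IsStrictlyGE (0 - 1)),
      inferInstanceAs ((0 : CochainComplex C ℤ).IsStrictlyLE (0 + 1))⟩
  exact le_antisymm ((ObjectProperty.triangEnvelope_le_iff _).2 fun X hX => hX.1)
    (isAcyclicKb_le_of_isShortAcyclicKb_le C _ (ObjectProperty.le_triangEnvelope _))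

/-- The quotient property of `Qb` is transported along the equivalence `yonedaDb`, which carries
maps with acyclic cone to maps with cone in `Thick(eff C)`. -/
instance : (mapDb (yonedaModLeftAdjoint C)).IsLocalization (thickEff C).trW := by
  obtain ⟨α, -⟩ := shiftIso_yonedaDb_comp_mapDb C
  refine Functor.IsLocalization.of_equivalence_source (Qb C) (isAcyclicKb C).trW _ _
    (yonedaDb C).asEquivalence ?_ ?_ α
  · rintro X Y s ⟨Z, g, h, hT, hZ⟩
    obtain ⟨δ, hδ⟩ := exists_distinguished_map (yonedaDb C) ⟨h, hT⟩
    have hZ' : thickEff C ((yonedaDb C).obj Z) :=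
      (thickEff_iff_isZero C _).2 ((isZero_mapDb_yonedaDb_iff C Z).2 hZ)
    have : (thickEff C).trW ((yonedaDb C).map s) := ⟨_, _, δ, hδ, hZ'⟩
    exact MorphismProperty.le_isoClosure _ _ this
  · intro X Y s hs
    exact (trW_iff_isIso_map _ (thickEff_iff_isZero C) s).1 hs

end

end DerivedAuslander

open DerivedAuslander
theorem mainTheorem4 (C : Type u) [Category.{v} C] [Abelian C] [HasDerivedCategory.{w₁} C]
    [HasDerivedCategory.{w₂} (FinPresFunctor C)] :
    -- Yoneda induces a triangle equivalence `Kᵇ(C) ≌ Dᵇ(mod C)`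
    ((yonedaDb C).IsTriangulated ∧ (yonedaDb C).IsEquivalence) ∧
    -- under which `Acᵇ(C)` corresponds to `Thick(eff C)`
    (isAcyclicKb C = (thickEff C).inverseImage (yonedaDb C) ∧
      ∃ h : ∀ X : (isAcyclicKb C).FullSubcategory,
          thickEff C (((isAcyclicKb C).ι ⋙ yonedaDb C).obj X),
        ((thickEff C).lift ((isAcyclicKb C).ι ⋙ yonedaDb C) h).IsTriangulated ∧
        ((thickEff C).lift ((isAcyclicKb C).ι ⋙ yonedaDb C) h).IsEquivalence) ∧
    -- `Kᵇ(C) ⥤ Dᵇ(C)` is the Verdier quotient functor by `Acᵇ(C)`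
    (Qb C).IsLocalization (isAcyclicKb C).trW ∧
    -- the Yoneda functor has an exact left adjoint `L`, and the induced functor
    -- `Dᵇ(mod C) ⥤ Dᵇ(C)` makes the diagram commute, has kernel `Thick(eff C)`, and induces an
    -- equivalence `Dᵇ(mod C) / Thick(eff C) ≌ Dᵇ(C)`
    (∃ (L : FinPresFunctor C ⥤ C) (_ : L ⊣ yonedaMod C) (_ : L.Additive)
        (_ : PreservesFiniteLimits L) (_ : PreservesFiniteColimits L),
      (mapDb L).IsTriangulated ∧
      (∃ α : yonedaDb C ⋙ mapDb L ≅ Qb C, NatTrans.CommShift α.hom ℤ) ∧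
      (∀ Y : DerivedCategory.Bounded (FinPresFunctor C),
        thickEff C Y ↔ IsZero ((mapDb L).obj Y)) ∧
      (mapDb L).IsLocalization (thickEff C).trW) ∧
    -- `Acᵇ(C)` is generated by the short acyclic complexes: it is the smallest thick subcategory
    -- of `Kᵇ(C)` containing them, and even the smallest strictly full triangulated one
    ((isShortAcyclicKb C).triangEnvelope = isAcyclicKb C ∧
      ∀ P : ObjectProperty (Kb C), P.IsTriangulated → P.IsClosedUnderIsomorphisms →
        isShortAcyclicKb C ≤ P → isAcyclicKb C ≤ P) := by
  have h (X : (isAcyclicKb C).FullSubcategory) :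
      thickEff C (((isAcyclicKb C).ι ⋙ yonedaDb C).obj X) :=
    (thickEff_iff_isZero C _).2 ((isZero_mapDb_yonedaDb_iff C X.obj).2 X.property)
  have : ((thickEff C).lift ((isAcyclicKb C).ι ⋙ yonedaDb C) h).EssSurj := ⟨fun Y => by
    let e := (yonedaDb C).objObjPreimageIso Y.obj
    refine ⟨⟨(yonedaDb C).objPreimage Y.obj, ?_⟩, ⟨(thickEff C).ι.preimageIso e⟩⟩
    -- An object of `Thick(eff C)` is killed by the induced functor, so its preimage is acyclic.
    have := (isZero_mapDb_yonedaDb_iff C ((yonedaDb C).objPreimage Y.obj)).1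
    exact this (((thickEff_iff_isZero C _).1 Y.property).of_iso ((mapDb _).mapIso e))⟩
  exact ⟨⟨inferInstance, inferInstance⟩,
    ⟨isAcyclicKb_eq_inverseImage C, h, inferInstance, {}⟩, inferInstance,
    ⟨yonedaModLeftAdjoint C, yonedaModAdjunction C, inferInstance, inferInstance, inferInstance,
      inferInstance, shiftIso_yonedaDb_comp_mapDb C, thickEff_iff_isZero C, inferInstance⟩,
    triangEnvelope_isShortAcyclicKb C,
    fun P _ _ hP => isAcyclicKb_le_of_isShortAcyclicKb_le C P hP⟩
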